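/- For a probability measure $\mu$ on $\mathbb{R}$ and $z\in\mathbb{C}\setminus\mathbb{R}$ let $H_\mu(z)=\left[\int_{\mathbb{R}}\frac{\mu(dx)}{z-x}\right]^{-1}$ be its reciprocal Cauchy transform, and let $M_k(\mu)=\int_{\mathbb R} x^k\,\mu(dx)$. The monotone convolution $\mu\triangleright\nu$ of two probability measures on $\mathbb{R}$ is the probability measure with $$H_{\mu\triangleright\nu}(z)=H_\mu(H_\nu(z)),\qquad \operatorname{Im} z\neq 0;$$ such a probability measure exists and is unique. The measures below may have noncompact support. (1) Let $\mu$ be a probability measure on $\mathbb{R}$ with finite moments of all orders, mean $0$ and variance $1$, and let $D_c\mu$ denote the image of $\mu$ under $x\mapsto cx$. Then the $N$-fold monotone convolution $D_{1/\sqrt N}\mu\triangleright\cdots\triangleright D_{1/\sqrt N}\mu$ converges weakly, as $N\to\infty$, to the arcsine law with mean $0$ and variance $1$, which has density $\frac{1}{\pi\sqrt{2-x^2}}$ on $(-\sqrt2,\sqrt2)$. (2) Let $\lambda>0$ and let $\mu^{(N)}$, $N\ge 1$, be probability measures on $\mathbb{R}$ with finite moments of all orders such that $N M_k(\mu^{(N)})\to\lambda$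 as $N\to\infty$ for every $k\ge1$. Then the $N$-fold monotone convolution $\mu^{(N)}\triangleright\cdots\triangleright\mu^{(N)}$ converges weakly, as $N\to\infty$, to the monotone Poisson distribution with parameter $\lambda$, that is, to the probability measure with moments $$M_n=\sum_{k=1}^{n}\frac{\lambda^k}{k!}\sum_{1=i_0<i_1<\cdots<i_{k-1}<i_k=n+1} i_0i_1\cdots i_{k-1},\qquad n\ge1;$$ a probability measure with these moments exists and is unique. -/

import Mathlib

open MeasureTheory ProbabilityTheory Filter Topology

noncomputable section

namespace MonotoneConv

/-- The Cauchy transform `G_μ(z) = ∫ μ(dx) / (z - x)`. -/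
def cauchyTransform (μ : ProbabilityMeasure ℝ) (z : ℂ) : ℂ :=
  ∫ x : ℝ, (z - (x : ℂ))⁻¹ ∂(μ : Measure ℝ)

/-- The reciprocal Cauchy transform `H_μ(z) = 1 / G_μ(z)`. -/
def recipCauchy (μ : ProbabilityMeasure ℝ) (z : ℂ) : ℂ :=
  (cauchyTransform μ z)⁻¹

/-- `ρ` is the monotone convolution of `μ` and `ν`: `H_ρ = H_μ ∘ H_ν` off the real axis. -/
def IsMonotoneConv (μ ν ρ : ProbabilityMeasure ℝ) : Prop :=
  ∀ z : ℂ, z.im ≠ 0 → recipCauchy ρ z = recipCauchy μ (recipCauchy ν z)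

/-- The monotone convolution `μ ▷ ν`: the probability measure with `H_{μ ▷ ν} = H_μ ∘ H_ν`. -/
def monotoneConv (μ ν : ProbabilityMeasure ℝ) : ProbabilityMeasure ℝ :=
  Classical.epsilon (IsMonotoneConv μ ν)

/-- The `N`-fold monotone convolution `μ ▷ ⋯ ▷ μ` for `N ≥ 1`; the value at `N = 0` is the
point mass at `0`, the neutral element. -/
def monotoneConvPow (μ : ProbabilityMeasure ℝ) : ℕ → ProbabilityMeasure ℝ
  | 0 => ⟨Measure.dirac 0, inferInstance⟩
  | 1 => μ
  | n + 2 => monotoneConv (monotoneConvPow μ (n + 1)) μ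

/-- The dilation `D_c μ`: the image of `μ` under `x ↦ c * x`. -/
def dilation (c : ℝ) (μ : ProbabilityMeasure ℝ) : ProbabilityMeasure ℝ :=
  μ.map (f := fun x : ℝ => c * x) (measurable_const_mul c).aemeasurable

/-- Finiteness of all moments. -/
def HasAllMoments (μ : ProbabilityMeasure ℝ) : Prop :=
  ∀ k : ℕ, Integrable (fun x : ℝ => x ^ k) (μ : Measure ℝ)

/-- The `k`-th moment `M_k(μ)`. -/
def moment (μ : ProbabilityMeasure ℝ) (k : ℕ) : ℝ :=
  ∫ x : ℝ, x ^ k ∂(μ : Measure ℝ)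

/-- The density `1 / (π √(2 - x²))` on `(-√2, √2)` of the arcsine law. -/
def arcsineDensity (x : ℝ) : ℝ := 1 / (Real.pi * √(2 - x ^ 2))

/-- The arcsine law with mean `0` and variance `1`, as a measure. -/
def arcsineMeasure : Measure ℝ :=
  (volume.restrict (Set.Ioo (-√2) √2)).withDensity (fun x => ENNReal.ofReal (arcsineDensity x))

theorem arcsineDensity_nonneg (x : ℝ) : 0 ≤ arcsineDensity x := by
  unfold arcsineDensity
  positivity

theorem hasDerivAt_arcsine_cdf {x : ℝ} (hx : x ∈ Set.Ioo (-√2) √2) :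
    HasDerivAt (fun y : ℝ => Real.arcsin (y / √2) / Real.pi) (arcsineDensity x) x := by
  have h2 : (0 : ℝ) < √2 := by positivity
  have hl : x / √2 ≠ -1 := by
    intro h
    rw [div_eq_iff h2.ne'] at h
    linarith [hx.1]
  have hr : x / √2 ≠ 1 := by
    intro h
    rw [div_eq_iff h2.ne'] at h
    linarith [hx.2]
  have hd := ((Real.hasDerivAt_arcsin hl hr).comp x ((hasDerivAt_id x).div_const √2)).div_const
    Real.pi
  have he : √(2 - x ^ 2) = √(1 - (x / √2) ^ 2) * √2 := by
    rw [← Real.sqrt_mul' _ (by norm_num)]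
    congr 1
    rw [div_pow, Real.sq_sqrt (by norm_num)]
    ring
  refine hd.congr_deriv ?_
  unfold arcsineDensity
  rw [he]
  field_simp

instance : IsProbabilityMeasure arcsineMeasure := by
  have h2 : (0 : ℝ) < √2 := by positivity
  have hle : -√2 ≤ √2 := by linarith
  have hcont : ContinuousOn (fun y : ℝ => Real.arcsin (y / √2) / Real.pi)
      (Set.Icc (-√2) √2) := by
    apply Continuous.continuousOn
    fun_prop
  have hint := intervalIntegral.integrableOn_deriv_of_nonneg hcont
    (fun x hx => hasDerivAt_arcsine_cdf hx) (fun x _ => arcsineDensity_nonneg x)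
  have hval := intervalIntegral.integral_eq_sub_of_hasDerivAt_of_le hle hcont
    (fun x hx => hasDerivAt_arcsine_cdf hx)
    ((intervalIntegrable_iff_integrableOn_Ioc_of_le hle).2 hint)
  have h1 : ∫ x in Set.Ioo (-√2) √2, arcsineDensity x = 1 := by
    rw [← integral_Ioc_eq_integral_Ioo, ← intervalIntegral.integral_of_le hle, hval]
    have : -√2 / √2 = -1 := by field_simp
    rw [this, div_self h2.ne', Real.arcsin_one, Real.arcsin_neg_one]
    field_simp
    norm_num
  constructor
  rw [arcsineMeasure, withDensity_apply _ MeasurableSet.univ, Measure.restrict_univ,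
    ← ofReal_integral_eq_lintegral_ofReal (hint.mono_set Set.Ioo_subset_Ioc_self)
      (Eventually.of_forall arcsineDensity_nonneg), h1, ENNReal.ofReal_one]

/-- The arcsine law with mean `0` and variance `1`. -/
def arcsineLaw : ProbabilityMeasure ℝ := ⟨arcsineMeasure, inferInstance⟩

/-- The moments
`∑_{k=1}^n (c^k / k!) ∑_{1 = i₀ < i₁ < ⋯ < i_{k-1} < i_k = n+1} i₀ i₁ ⋯ i_{k-1}`
of the monotone Poisson distribution with parameter `c`, for `n ≥ 1`. The inner sum runs over the
sets `s = {i₀, …, i_{k-1}}`, i.e. the `k`-element subsets of `{1, …, n}` that contain `1`. -/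
def monotonePoissonMoment (c : ℝ) (n : ℕ) : ℝ :=
  ∑ k ∈ Finset.Icc 1 n, c ^ k / (k.factorial : ℝ) *
    ∑ s ∈ (Finset.powersetCard k (Finset.Icc 1 n)).filter (fun s => 1 ∈ s), ∏ i ∈ s, (i : ℝ)

/-- `ρ` is a probability measure with the monotone Poisson moments of parameter `c`. -/
def IsMonotonePoisson (c : ℝ) (ρ : ProbabilityMeasure ℝ) : Prop :=
  HasAllMoments ρ ∧ ∀ n : ℕ, 1 ≤ n → moment ρ n = monotonePoissonMoment c n

/-- The monotone Poisson distribution with parameter `c`: the probability measure with the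
monotone Poisson moments (their moment problem is determinate). -/
def monotonePoisson (c : ℝ) : ProbabilityMeasure ℝ :=
  Classical.epsilon (IsMonotonePoisson c)

end MonotoneConv

end

open MeasureTheory ProbabilityTheory Filter Topology

namespace MonotoneConv

/-! Everything is read off the Cauchy transform `G` and its reciprocal `H` in the upper half-plane.
If `G` converges pointwise on some `R < Im z` to a function `F` with `iy F(iy) → 1`, the measures
are tight and `F` is a Cauchy transform there (`exists_cauchyTransform_eq`,
`tendsto_of_tendsto_cauchyTransform`). So both limit theorems are statements about the iterates of
`H`. These are under control because `H` never lowers the imaginary part (`im_le_im_recipCauchy`),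
which also removes any need for compact support.

Existence of the convolution: if `μ = ∑ q_j δ_{c_j}`, then `G_μ(H_ν) = ∑ q_j / (H_ν - c_j)`. For
finitely supported `ν`, the function `1 / (H_ν - c)` is the Cauchy transform of a spectral measure
of a rank one perturbation (`exists_rank_one_perturbation`). General measures follow by two
successive limits.

Central limit theorem: in the coordinate `w²`, one application of `H` is nearly the translation by
`-2 M_2` (`norm_recipCauchy_sq_sub_le`). With `M_2 = 1/N`, the `N` steps send `z²` to `z² - 2` up to
`O(N^{-1/2})`, and the arcsine law satisfies `H(z)² = z² - 2`.

Law of small numbers: one application of `H` is nearly an Euler step of length `λ/N` for the vector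
field `V(w) = -w/(w-1)`. The generating series `Q(t,z)` of the monotone Poisson moments solves `∂ₜQ
= V ∂_z Q` with `Q(0,z) = 1/z`, so `Q` is constant along the flow with time run backwards. Hence the
reciprocal of the `N`-th iterate at `z` tends to `Q(λ,z)`. The limit measure itself is obtained by
running this argument on Bernoulli laws and recovering its moments from the expansion at infinity
(`hasAllMoments_of_cauchyTransform_eq`). -/

/-! ### Cauchy transforms in the upper half-plane. -/

theorem sub_ofReal_ne_zero {z : ℂ} (hz : z.im ≠ 0) (x : ℝ) : z - (x : ℂ) ≠ 0 := by
  intro h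
  have := congrArg Complex.im h
  simp at this
  exact hz this

theorem im_le_norm_sub_ofReal (z : ℂ) (x : ℝ) : z.im ≤ ‖z - (x : ℂ)‖ := by
  have := Complex.abs_im_le_norm (z - (x : ℂ))
  simp only [Complex.sub_im, Complex.ofReal_im, sub_zero] at this
  exact (le_abs_self _).trans this

theorem norm_inv_sub_ofReal_le {z : ℂ} (hz : 0 < z.im) (x : ℝ) :
    ‖(z - (x : ℂ))⁻¹‖ ≤ z.im⁻¹ := by
  rw [norm_inv]
  exact inv_anti₀ hz (im_le_norm_sub_ofReal z x)

theorem norm_inv_sub_ofReal_le_abs {z : ℂ} (hz : z.im ≠ 0) (x : ℝ) :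
    ‖(z - (x : ℂ))⁻¹‖ ≤ |z.im|⁻¹ := by
  rw [norm_inv]
  refine inv_anti₀ (abs_pos.2 hz) ?_
  simpa using Complex.abs_im_le_norm (z - (x : ℂ))

theorem continuous_inv_sub_ofReal {z : ℂ} (hz : z.im ≠ 0) :
    Continuous fun x : ℝ => (z - (x : ℂ))⁻¹ :=
  (continuous_const.sub Complex.continuous_ofReal).inv₀ (sub_ofReal_ne_zero hz)

theorem integrable_inv_sub_ofReal (μ : ProbabilityMeasure ℝ) {z : ℂ} (hz : z.im ≠ 0) :
    Integrable (fun x : ℝ => (z - (x : ℂ))⁻¹) (μ : Measure ℝ) :=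
  Integrable.of_bound (continuous_inv_sub_ofReal hz).aestronglyMeasurable (|z.im|⁻¹)
    (Eventually.of_forall fun x => norm_inv_sub_ofReal_le_abs hz x)

theorem cauchyTransform_conj (μ : ProbabilityMeasure ℝ) (z : ℂ) :
    cauchyTransform μ (starRingEnd ℂ z) = starRingEnd ℂ (cauchyTransform μ z) := by
  unfold cauchyTransform
  rw [← integral_conj]
  simp

theorem recipCauchy_conj (μ : ProbabilityMeasure ℝ) (z : ℂ) :
    recipCauchy μ (starRingEnd ℂ z) = starRingEnd ℂ (recipCauchy μ z) := by
  simp [recipCauchy, cauchyTransform_conj]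

theorem im_inv_sub_ofReal (z : ℂ) (x : ℝ) :
    ((z - (x : ℂ))⁻¹).im = -(z.im * ‖(z - (x : ℂ))⁻¹‖ ^ 2) := by
  rw [Complex.inv_im, norm_inv, inv_pow, ← Complex.normSq_eq_norm_sq]
  simp [div_eq_mul_inv]

theorem im_cauchyTransform (μ : ProbabilityMeasure ℝ) {z : ℂ} (hz : z.im ≠ 0) :
    (cauchyTransform μ z).im = -(z.im * ∫ x : ℝ, ‖(z - (x : ℂ))⁻¹‖ ^ 2 ∂(μ : Measure ℝ)) := by
  have h := integral_im (integrable_inv_sub_ofReal μ hz)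
  simp only [RCLike.im_to_complex] at h
  rw [cauchyTransform, ← h, ← integral_const_mul, ← integral_neg]
  simp_rw [im_inv_sub_ofReal]

theorem norm_integral_sq_le (μ : Measure ℝ) [IsProbabilityMeasure μ] {f : ℝ → ℂ}
    (hf : Integrable f μ) (hf2 : Integrable (fun x => ‖f x‖ ^ 2) μ) :
    ‖∫ x, f x ∂μ‖ ^ 2 ≤ ∫ x, ‖f x‖ ^ 2 ∂μ := by
  exact ((convexOn_univ_norm (E := ℂ)).pow (fun _ _ => norm_nonneg _) 2).map_integral_le
    (continuous_norm.pow 2).continuousOn isClosed_univ (Eventually.of_forall fun _ => Set.mem_univ _)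
    hf hf2

theorem integrable_norm_inv_sub_sq (μ : ProbabilityMeasure ℝ) {z : ℂ} (hz : z.im ≠ 0) :
    Integrable (fun x : ℝ => ‖(z - (x : ℂ))⁻¹‖ ^ 2) (μ : Measure ℝ) := by
  refine Integrable.of_bound ((continuous_inv_sub_ofReal hz).norm.pow 2).aestronglyMeasurable
    (|z.im|⁻¹ ^ 2) (Eventually.of_forall fun x => ?_)
  rw [norm_pow, norm_norm]
  gcongr
  exact norm_inv_sub_ofReal_le_abs hz x

theorem im_cauchyTransform_neg (μ : ProbabilityMeasure ℝ) {z : ℂ} (hz : 0 < z.im) :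
    (cauchyTransform μ z).im < 0 := by
  rw [im_cauchyTransform μ hz.ne', neg_lt_zero]
  refine mul_pos hz ?_
  rw [integral_pos_iff_support_of_nonneg (fun x => by positivity)
    (integrable_norm_inv_sub_sq μ hz.ne')]
  have : Function.support (fun x : ℝ => ‖(z - (x : ℂ))⁻¹‖ ^ 2) = Set.univ := by
    ext x
    simp [sub_ofReal_ne_zero hz.ne' x]
  rw [this]
  simp

theorem cauchyTransform_ne_zero (μ : ProbabilityMeasure ℝ) {z : ℂ} (hz : 0 < z.im) :
    cauchyTransform μ z ≠ 0 := fun h => by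
  have := im_cauchyTransform_neg μ hz
  simp [h] at this

/-- The ratio `Im H(z) / Im z` equals `∫ |z-x|⁻² dμ / |∫ (z-x)⁻¹ dμ|²`, which Jensen bounds below by
`1`. Hence iterates of `H` stay in every half-plane in which they start. -/
theorem im_le_im_recipCauchy (μ : ProbabilityMeasure ℝ) {z : ℂ} (hz : 0 < z.im) :
    z.im ≤ (recipCauchy μ z).im := by
  have hG := cauchyTransform_ne_zero μ hz
  have hpos : 0 < ‖cauchyTransform μ z‖ ^ 2 := by positivity
  rw [recipCauchy, Complex.inv_im, Complex.normSq_eq_norm_sq, le_div_iff₀ hpos,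
    im_cauchyTransform μ hz.ne', neg_neg]
  exact mul_le_mul_of_nonneg_left (norm_integral_sq_le _ (integrable_inv_sub_ofReal μ hz.ne')
    (integrable_norm_inv_sub_sq μ hz.ne')) hz.le

theorem hasDerivAt_cauchyTransform (μ : ProbabilityMeasure ℝ) {z : ℂ} (hz : 0 < z.im) :
    HasDerivAt (cauchyTransform μ) (∫ x : ℝ, -((z - (x : ℂ)) ^ 2)⁻¹ ∂(μ : Measure ℝ)) z := by
  have hs : {w : ℂ | z.im / 2 < w.im} ∈ 𝓝 z :=
    (isOpen_lt continuous_const Complex.continuous_im).mem_nhds (by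
      show z.im / 2 < z.im
      linarith)
  refine (hasDerivAt_integral_of_dominated_loc_of_deriv_le (F := fun w (x : ℝ) => (w - (x : ℂ))⁻¹)
    (F' := fun w (x : ℝ) => -((w - (x : ℂ)) ^ 2)⁻¹)
    (bound := fun _ => ((z.im / 2)⁻¹) ^ 2) hs ?_ (integrable_inv_sub_ofReal μ hz.ne') ?_ ?_
    (integrable_const _) ?_).2
  · filter_upwards [hs] with w hw
    have hw' : w.im ≠ 0 := by
      have : z.im / 2 < w.im := hw
      linarith
    exact (continuous_inv_sub_ofReal hw').aestronglyMeasurable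
  · exact (((continuous_const.sub Complex.continuous_ofReal).pow 2).inv₀ fun x =>
      pow_ne_zero 2 (sub_ofReal_ne_zero hz.ne' x)).neg.aestronglyMeasurable
  · refine Eventually.of_forall fun x w (hw : z.im / 2 < w.im) => ?_
    rw [norm_neg, ← inv_pow, norm_pow]
    gcongr
    exact (norm_inv_sub_ofReal_le (by linarith) x).trans (inv_anti₀ (by linarith) hw.le)
  · refine Eventually.of_forall fun x w (hw : z.im / 2 < w.im) => ?_
    have h := ((hasDerivAt_id w).sub_const (x : ℂ)).inv
      (sub_ofReal_ne_zero (by linarith : w.im ≠ 0) x)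
    refine h.congr_deriv ?_
    simp [div_eq_mul_inv]

theorem tendsto_cauchyTransform {ι : Type*} {l : Filter ι} {μ : ι → ProbabilityMeasure ℝ}
    {ν : ProbabilityMeasure ℝ} (h : Tendsto μ l (𝓝 ν)) {z : ℂ} (hz : z.im ≠ 0) :
    Tendsto (fun n => cauchyTransform (μ n) z) l (𝓝 (cauchyTransform ν z)) := by
  rw [ProbabilityMeasure.tendsto_iff_forall_integral_rclike_tendsto ℂ] at h
  exact h (BoundedContinuousFunction.ofNormedAddCommGroup _ (continuous_inv_sub_ofReal hz) _
    (norm_inv_sub_ofReal_le_abs hz))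

/-- Nontangential behaviour of the Cauchy transform at infinity. -/
theorem tendsto_mul_cauchyTransform {ι : Type*} {l : Filter ι} [l.IsCountablyGenerated]
    (μ : ProbabilityMeasure ℝ) {w : ι → ℂ} {C : ℝ} (hw : Tendsto (fun i => (w i).im) l atTop)
    (hC : ∀ᶠ i in l, ‖w i‖ ≤ C * (w i).im) :
    Tendsto (fun i => w i * cauchyTransform μ (w i)) l (𝓝 1) := by
  have key : Tendsto (fun i => ∫ x : ℝ, w i * (w i - x)⁻¹ ∂(μ : Measure ℝ)) l
      (𝓝 (∫ _x : ℝ, (1 : ℂ) ∂(μ : Measure ℝ))) := by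
    refine tendsto_integral_filter_of_dominated_convergence (fun _ => C) ?_ ?_
      (integrable_const _) (Eventually.of_forall fun x => ?_)
    · filter_upwards [hw.eventually_gt_atTop 0] with i hi
      exact (continuous_const.mul (continuous_inv_sub_ofReal hi.ne')).aestronglyMeasurable
    · filter_upwards [hw.eventually_gt_atTop 0, hC] with i hi hCi
      refine Eventually.of_forall fun x => ?_
      rw [norm_mul]
      calc _ ≤ (C * (w i).im) * ((w i).im)⁻¹ := by
            gcongr
            · exact (norm_nonneg _).trans hCi
            · exact norm_inv_sub_ofReal_le hi x
        _ = C := by field_simp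
    · have h0 : Tendsto (fun i => (x : ℂ) * (w i - x)⁻¹) l (𝓝 0) := by
        refine squeeze_zero_norm' (a := fun i => |x| * ((w i).im)⁻¹) ?_ ?_
        · filter_upwards [hw.eventually_gt_atTop 0] with i hi
          rw [norm_mul, Complex.norm_real, Real.norm_eq_abs]
          gcongr
          exact norm_inv_sub_ofReal_le hi x
        · simpa using (tendsto_inv_atTop_zero.comp hw).const_mul |x|
      have h1 := h0.const_add 1
      rw [add_zero] at h1
      refine h1.congr' ?_
      filter_upwards [hw.eventually_gt_atTop 0] with i hi
      have := sub_ofReal_ne_zero hi.ne' x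
      field_simp
      ring
  simp only [integral_const_mul, integral_const, probReal_univ, one_smul] at key
  exact key

theorem tendsto_mul_cauchyTransform_I (μ : ProbabilityMeasure ℝ) :
    Tendsto (fun y : ℝ => (y * Complex.I) * cauchyTransform μ (y * Complex.I)) atTop (𝓝 1) := by
  refine tendsto_mul_cauchyTransform μ (C := 1)
    (by simp only [Complex.mul_I_im, Complex.ofReal_re]; exact tendsto_id) ?_
  filter_upwards [eventually_gt_atTop 0] with y hy
  simp [abs_of_pos hy]

/-- A tail bound in terms of the Cauchy transform on the imaginary axis. -/
theorem measureReal_abs_ge_le (μ : ProbabilityMeasure ℝ) {y : ℝ} (hy : 0 < y) :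
    (μ : Measure ℝ).real {x | y ≤ |x|} ≤
      2 * (1 - ((y * Complex.I) * cauchyTransform μ (y * Complex.I)).re) := by
  have him : (y * Complex.I : ℂ).im = y := by simp
  have h1 : ((y * Complex.I) * cauchyTransform μ (y * Complex.I)).re
      = ∫ x : ℝ, y ^ 2 * ‖((y * Complex.I : ℂ) - (x : ℂ))⁻¹‖ ^ 2 ∂(μ : Measure ℝ) := by
    rw [Complex.mul_re, him, im_cauchyTransform μ (by rw [him]; exact hy.ne'), him,
      integral_const_mul]
    simp
    ring
  have hint := (integrable_norm_inv_sub_sq μ (z := y * Complex.I)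
    (by rw [him]; exact hy.ne')).const_mul (y ^ 2)
  have hns (x : ℝ) : ‖((y * Complex.I : ℂ) - (x : ℂ))⁻¹‖ ^ 2 = (x ^ 2 + y ^ 2)⁻¹ := by
    rw [norm_inv, inv_pow, ← Complex.normSq_eq_norm_sq, Complex.normSq_apply]
    simp
    ring
  -- The integrand is `2 x² / (x² + y²)`, which is nonnegative and at least `1` where `|x| ≥ y`.
  have h2 : 2 * (1 - ((y * Complex.I) * cauchyTransform μ (y * Complex.I)).re)
      = ∫ x : ℝ, 2 * (1 - y ^ 2 * (x ^ 2 + y ^ 2)⁻¹) ∂(μ : Measure ℝ) := by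
    rw [h1, integral_const_mul 2,
      integral_sub (integrable_const _) (by simpa only [hns] using hint)]
    simp only [hns]
    simp
  have hmeas : MeasurableSet {x : ℝ | y ≤ |x|} :=
    measurableSet_le measurable_const measurable_id.abs
  rw [h2, ← integral_indicator_one hmeas]
  refine integral_mono ?_ ?_ ?_
  · exact (integrable_const (1 : ℝ)).indicator hmeas
  · exact ((integrable_const _).sub (by simpa only [hns] using hint)).const_mul 2
  · intro x
    have hpos : 0 < x ^ 2 + y ^ 2 := by positivity
    have hle : y ^ 2 * (x ^ 2 + y ^ 2)⁻¹ ≤ 1 := by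
      rw [← div_eq_mul_inv, div_le_one hpos]
      nlinarith [sq_nonneg x]
    by_cases hx : y ≤ |x|
    · have hxy : y ^ 2 ≤ x ^ 2 := by
        rw [← sq_abs x]
        gcongr
      have : y ^ 2 * (x ^ 2 + y ^ 2)⁻¹ ≤ 1 / 2 := by
        rw [← div_eq_mul_inv, div_le_iff₀ hpos]
        linarith
      simp only [Set.indicator, Set.mem_ofPred_eq, hx, if_true, Pi.one_apply]
      linarith
    · simp only [Set.indicator, Set.mem_ofPred_eq, hx, if_false]
      linarith

/-! ### Stieltjes inversion and uniqueness. -/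

theorem norm_inv_sub_ofReal_sq (t y x : ℝ) :
    ‖((t + y * Complex.I : ℂ) - (x : ℂ))⁻¹‖ ^ 2 = ((t - x) ^ 2 + y ^ 2)⁻¹ := by
  rw [norm_inv, inv_pow, ← Complex.normSq_eq_norm_sq, Complex.normSq_apply]
  simp
  ring

theorem integral_comp_add_mul_cauchyMeasure (f : BoundedContinuousFunction ℝ ℝ) (x : ℝ)
    {y : NNReal} (hy : y ≠ 0) :
    ∫ u, f (x + y * u) ∂(cauchyMeasure 0 1) = ∫ t, f t * cauchyPDFReal x y t := by
  have hy' : (y : ℝ) ≠ 0 := by exact_mod_cast hy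
  rw [cauchyMeasure_of_scale_ne_zero 0 one_ne_zero,
    integral_withDensity_eq_integral_toReal_smul (measurable_cauchyPDF 0 1)
      (Eventually.of_forall fun _ => by simp [cauchyPDF])]
  have h1 : ∀ u : ℝ, (cauchyPDF 0 1 u).toReal • f (x + y * u)
      = y * (fun t => f t * cauchyPDFReal x y t) (x + y * u) := by
    intro u
    rw [cauchyPDF, ENNReal.toReal_ofReal (cauchyPDF_pos 0 one_ne_zero u).le, cauchyPDFReal_def,
      smul_eq_mul]
    simp only [cauchyPDFReal_def]
    have h2 : (x + y * u - x) ^ 2 + (y : ℝ) ^ 2 = y ^ 2 * ((u - 0) ^ 2 + ((1 : NNReal) : ℝ) ^ 2) := by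
      push_cast
      ring
    have h3 : (u - 0) ^ 2 + ((1 : NNReal) : ℝ) ^ 2 ≠ 0 := by
      push_cast
      positivity
    rw [h2]
    push_cast at h3 ⊢
    field_simp
  simp_rw [h1]
  rw [integral_const_mul, Measure.integral_comp_mul_left
    (fun v => (fun t => f t * cauchyPDFReal x y t) (x + v)),
    integral_add_left_eq_self (fun t => f t * cauchyPDFReal x y t) x,
    smul_eq_mul, abs_of_nonneg (by positivity), mul_inv_cancel_left₀ hy']

/-- By Fubini, `-π⁻¹ Im G(t + iy)` is the density of the convolution of `μ` with the Cauchy law of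
scale `y`. -/
theorem integral_smooth_eq (μ : ProbabilityMeasure ℝ) (f : BoundedContinuousFunction ℝ ℝ)
    {y : NNReal} (hy : y ≠ 0) :
    ∫ x, ∫ u, f (x + y * u) ∂(cauchyMeasure 0 1) ∂(μ : Measure ℝ)
      = ∫ t : ℝ, f t * -(Real.pi⁻¹ * (cauchyTransform μ (t + y * Complex.I)).im) := by
  have hy' : (y : ℝ) ≠ 0 := by exact_mod_cast hy
  simp_rw [integral_comp_add_mul_cauchyMeasure f _ hy]
  have hmeas : Measurable (Function.uncurry fun x t : ℝ => cauchyPDFReal x y t) := by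
    unfold Function.uncurry cauchyPDFReal
    fun_prop
  have hint : Integrable (Function.uncurry fun x t : ℝ => cauchyPDFReal x y t)
      ((μ : Measure ℝ).prod volume) := by
    rw [integrable_prod_iff hmeas.aestronglyMeasurable]
    refine ⟨Eventually.of_forall fun x => integrable_cauchyPDFReal x, ?_⟩
    have : (fun x : ℝ => ∫ t, ‖Function.uncurry (fun x t : ℝ => cauchyPDFReal x y t) (x, t)‖)
        = fun _ => 1 := by
      ext x
      rw [← integral_cauchyPDFReal_eq_one x hy]
      refine integral_congr_ae (Eventually.of_forall fun t => ?_)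
      simp [abs_of_pos (cauchyPDF_pos x hy t)]
    rw [this]
    exact integrable_const _
  rw [integral_integral_swap]
  · refine integral_congr_ae (Eventually.of_forall fun t => ?_)
    simp only
    rw [integral_const_mul, im_cauchyTransform μ (by simpa using hy')]
    congr 1
    simp only [norm_inv_sub_ofReal_sq, cauchyPDFReal_def, integral_const_mul]
    simp
    ring
  · refine hint.bdd_mul (c := ‖f‖) ?_ (Eventually.of_forall fun p => f.norm_coe_le_norm p.2)
    exact (f.continuous.comp continuous_snd).aestronglyMeasurable

/-- Writing the kernel as a rescaled fixed Cauchy law turns the approximate identity into two uses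
of dominated convergence. -/
theorem tendsto_integral_smooth (μ : ProbabilityMeasure ℝ) (f : BoundedContinuousFunction ℝ ℝ) :
    Tendsto (fun n : ℕ => ∫ x, ∫ u, f (x + ((1 / ((n : NNReal) + 1) : NNReal) : ℝ) * u)
      ∂(cauchyMeasure 0 1) ∂(μ : Measure ℝ)) atTop (𝓝 (∫ x, f x ∂(μ : Measure ℝ))) := by
  have h0 : Tendsto (fun n : ℕ => ((1 / ((n : NNReal) + 1) : NNReal) : ℝ)) atTop (𝓝 0) := by
    push_cast
    exact tendsto_one_div_add_atTop_nhds_zero_nat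
  refine tendsto_integral_of_dominated_convergence (fun _ => ‖f‖) (fun n => ?_)
    (integrable_const _) (fun n => Eventually.of_forall fun x => ?_)
    (Eventually.of_forall fun x => ?_)
  · have : StronglyMeasurable (Function.uncurry fun x u : ℝ =>
        f (x + ((1 / ((n : NNReal) + 1) : NNReal) : ℝ) * u)) :=
      Continuous.stronglyMeasurable (by fun_prop)
    exact this.integral_prod_right.aestronglyMeasurable
  · simpa using norm_integral_le_of_norm_le_const (μ := cauchyMeasure 0 1)
      (Eventually.of_forall fun u => f.norm_coe_le_norm
        (x + ((1 / ((n : NNReal) + 1) : NNReal) : ℝ) * u))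
  · have hx : f x = ∫ u, f x ∂(cauchyMeasure 0 1) := by simp
    rw [hx]
    refine tendsto_integral_of_dominated_convergence (fun _ => ‖f‖) (fun n => ?_)
      (integrable_const _) (fun n => Eventually.of_forall fun u => f.norm_coe_le_norm _)
      (Eventually.of_forall fun u => ?_)
    · exact Continuous.aestronglyMeasurable (by fun_prop)
    · refine (f.continuous.tendsto x).comp ?_
      simpa using (h0.mul_const u).const_add x

theorem eq_of_cauchyTransform_eq {μ ν : ProbabilityMeasure ℝ}
    (h : ∀ z : ℂ, 0 < z.im → cauchyTransform μ z = cauchyTransform ν z) : μ = ν := by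
  refine Subtype.ext (ext_of_forall_integral_eq_of_IsFiniteMeasure (μ := (μ : Measure ℝ))
    (ν := (ν : Measure ℝ)) fun f => ?_)
  refine tendsto_nhds_unique (tendsto_integral_smooth μ f) ?_
  refine (tendsto_integral_smooth ν f).congr fun n => ?_
  have hy : (1 / ((n : NNReal) + 1) : NNReal) ≠ 0 := by positivity
  rw [integral_smooth_eq μ f hy, integral_smooth_eq ν f hy]
  refine integral_congr_ae (Eventually.of_forall fun t => ?_)
  simp only
  rw [h]
  have : (0 : ℝ) < ((1 / ((n : NNReal) + 1) : NNReal) : ℝ) := by positivity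
  rw [Complex.add_im, Complex.ofReal_im, Complex.mul_I_im, Complex.ofReal_re, zero_add]
  exact this

/-- The identity theorem carries equality to the whole upper half-plane; the moment series give `G`
only far from the axis. -/
theorem eq_of_cauchyTransform_eq_of_im_gt {μ ν : ProbabilityMeasure ℝ} {R : ℝ} (hR : 0 ≤ R)
    (h : ∀ z : ℂ, R < z.im → cauchyTransform μ z = cauchyTransform ν z) : μ = ν := by
  refine eq_of_cauchyTransform_eq ?_
  have hU : IsOpen {z : ℂ | 0 < z.im} := isOpen_lt continuous_const Complex.continuous_im
  have han (ρ : ProbabilityMeasure ℝ) : AnalyticOnNhd ℂ (cauchyTransform ρ) {z : ℂ | 0 < z.im} :=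
    DifferentiableOn.analyticOnNhd (fun z hz =>
      (hasDerivAt_cauchyTransform ρ hz).differentiableAt.differentiableWithinAt) hU
  have hz₀ : ((R + 1 : ℝ) * Complex.I : ℂ).im = R + 1 := by simp
  refine (han μ).eqOn_of_preconnected_of_eventuallyEq (han ν)
    (convex_halfSpace_im_gt 0).isPreconnected (z₀ := ((R + 1 : ℝ) * Complex.I)) ?_ ?_
  · show 0 < ((R + 1 : ℝ) * Complex.I : ℂ).im
    rw [hz₀]
    linarith
  · filter_upwards [(isOpen_lt continuous_const Complex.continuous_im).mem_nhds
      (show R < ((R + 1 : ℝ) * Complex.I : ℂ).im by rw [hz₀]; linarith)] with z hz using h z hz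

/-! ### Tightness and weak convergence from Cauchy transforms. -/

/-- The tail bound gives `limsup_n ρ_n(|x| > y) ≤ 2(1 - Re(iy F(y)))`, and the right side vanishes
as `y → ∞`. Only the imaginary axis matters. -/
theorem isTightMeasureSet_of_tendsto_cauchyTransform {ρ : ℕ → ProbabilityMeasure ℝ} {F : ℝ → ℂ}
    {R : ℝ} (h : ∀ y : ℝ, R < y →
      Tendsto (fun n => cauchyTransform (ρ n) (y * Complex.I)) atTop (𝓝 (F y)))
    (hF : Tendsto (fun y : ℝ => (y * Complex.I) * F y) atTop (𝓝 1)) :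
    IsTightMeasureSet (Set.range fun n => (ρ n : Measure ℝ)) := by
  refine isTightMeasureSet_range_of_tendsto_limsup_measure_norm_gt ?_
  have h0 : Tendsto (fun y : ℝ => ENNReal.ofReal (2 * (1 - ((y * Complex.I) * F y).re))) atTop
      (𝓝 0) := by
    have h1 := (Complex.continuous_re.tendsto 1).comp hF
    have h2 := ENNReal.tendsto_ofReal ((h1.const_sub 1).const_mul 2)
    simpa using h2
  refine tendsto_of_tendsto_of_tendsto_of_le_of_le' tendsto_const_nhds h0
    (Eventually.of_forall fun _ => bot_le) ?_
  filter_upwards [eventually_gt_atTop R, eventually_gt_atTop 0] with y hy hy0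
  have h1 := (Complex.continuous_re.tendsto _).comp ((h y hy).const_mul (y * Complex.I))
  have h2 := ENNReal.tendsto_ofReal ((h1.const_sub 1).const_mul 2)
  rw [← h2.limsup_eq]
  refine limsup_le_limsup (Eventually.of_forall fun n => ?_)
  refine (measure_mono fun x hx => ?_).trans
    ((ENNReal.le_ofReal_iff_toReal_le (measure_ne_top _ _) ?_).2 (measureReal_abs_ge_le (ρ n) hy0))
  · exact (show y < ‖x‖ from hx).le
  · exact measureReal_nonneg.trans (measureReal_abs_ge_le (ρ n) hy0)

theorem exists_tendsto_ultrafilter {ρ : ℕ → ProbabilityMeasure ℝ}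
    (h : IsTightMeasureSet (Set.range fun n => (ρ n : Measure ℝ))) (U : Ultrafilter ℕ) :
    ∃ ν, Tendsto ρ U (𝓝 ν) := by
  have hc : IsCompact (closure (Set.range ρ)) := by
    refine isCompact_closure_of_isTightMeasureSet ?_
    convert h using 1
    ext
    simp
  obtain ⟨ν, -, hν⟩ := hc.ultrafilter_le_nhds (U.map ρ)
    (.trans (by simp) (monotone_principal subset_closure))
  exact ⟨ν, hν⟩

/-- A pointwise limit of Cauchy transforms with the right behaviour at infinity is a Cauchy
transform. -/
theorem exists_cauchyTransform_eq {ρ : ℕ → ProbabilityMeasure ℝ} {F : ℂ → ℂ}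
    {R : ℝ} (hR : 0 ≤ R) (h : ∀ z : ℂ, R < z.im →
      Tendsto (fun n => cauchyTransform (ρ n) z) atTop (𝓝 (F z)))
    (hF : Tendsto (fun y : ℝ => (y * Complex.I) * F (y * Complex.I)) atTop (𝓝 1)) :
    ∃ ν : ProbabilityMeasure ℝ, ∀ z : ℂ, R < z.im → cauchyTransform ν z = F z := by
  obtain ⟨ν, hν⟩ := exists_tendsto_ultrafilter
    (isTightMeasureSet_of_tendsto_cauchyTransform (F := fun y => F (y * Complex.I)) (R := R)
      (fun y hy => h _ (by simpa using hy)) hF) (hyperfilter ℕ)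
  refine ⟨ν, fun z hz => ?_⟩
  exact tendsto_nhds_unique (tendsto_cauchyTransform hν (by linarith))
    ((h z hz).mono_left (by simpa using Nat.hyperfilter_le_atTop))

/-- Tightness gives a limit along every ultrafilter, and its Cauchy transform forces that limit to
be `ν`. -/
theorem tendsto_of_tendsto_cauchyTransform {ρ : ℕ → ProbabilityMeasure ℝ}
    {ν : ProbabilityMeasure ℝ} {R : ℝ} (hR : 0 ≤ R) (h : ∀ z : ℂ, R < z.im →
      Tendsto (fun n => cauchyTransform (ρ n) z) atTop (𝓝 (cauchyTransform ν z))) :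
    Tendsto ρ atTop (𝓝 ν) := by
  have ht := isTightMeasureSet_of_tendsto_cauchyTransform
    (F := fun y => cauchyTransform ν (y * Complex.I)) (R := R)
      (fun y hy => h _ (by simpa using hy)) (tendsto_mul_cauchyTransform_I ν)
  refine (Filter.tendsto_iff_ultrafilter _ _ _).2 fun U hU => ?_
  obtain ⟨ν', hν'⟩ := exists_tendsto_ultrafilter ht U
  have : ν' = ν := eq_of_cauchyTransform_eq_of_im_gt hR fun z hz =>
    tendsto_nhds_unique (tendsto_cauchyTransform hν' (by linarith)) ((h z hz).mono_left hU)
  rwa [← this]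

/-! ### Existence and uniqueness of the monotone convolution. -/

theorem exists_cauchyTransform_eq_sum {ι : Type*} [Fintype ι] (p k : ι → ℝ) (hp : ∀ i, 0 ≤ p i)
    (hsum : ∑ i, p i = 1) :
    ∃ ρ : ProbabilityMeasure ℝ, ∀ z : ℂ,
      cauchyTransform ρ z = ∑ i, (p i : ℂ) * (z - (k i : ℂ))⁻¹ := by
  refine ⟨⟨∑ i, ENNReal.ofReal (p i) • Measure.dirac (k i), ⟨?_⟩⟩, fun z => ?_⟩
  · simp [← ENNReal.ofReal_sum_of_nonneg fun i _ => hp i, hsum]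
  · change ∫ x : ℝ, (z - (x : ℂ))⁻¹ ∂(∑ i, ENNReal.ofReal (p i) • Measure.dirac (k i)) = _
    rw [integral_finsetSum_measure]
    · refine Finset.sum_congr rfl fun i _ => ?_
      rw [integral_smul_measure, integral_dirac, ENNReal.toReal_ofReal (hp i)]
      simp
    · intro i _
      exact (integrable_dirac (by simp)).smul_measure ENNReal.ofReal_ne_top

/-- The spectral measure of a rank one perturbation of a real diagonal matrix. -/
theorem exists_rank_one_perturbation {ι : Type*} [Fintype ι] [DecidableEq ι] (a w : ι → ℝ)
    (hw : ∀ i, 0 ≤ w i) (hsum : ∑ i, w i = 1) (x : ℝ) :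
    ∃ p k : ι → ℝ, (∀ i, 0 ≤ p i) ∧ ∑ i, p i = 1 ∧ ∀ z : ℂ, z.im ≠ 0 →
      ∑ i, (w i : ℂ) * (z - (a i : ℂ))⁻¹ ≠ 0 →
      ∑ i, (p i : ℂ) * (z - (k i : ℂ))⁻¹ =
        ((∑ i, (w i : ℂ) * (z - (a i : ℂ))⁻¹)⁻¹ - x)⁻¹ := by
  set v : EuclideanSpace ℂ ι := WithLp.toLp 2 fun i => ((√(w i) : ℝ) : ℂ) with hv
  have hvi (i : ι) : v i * v i = (w i : ℂ) := by
    simp only [hv]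
    rw [← Complex.ofReal_mul, Real.mul_self_sqrt (hw i)]
  have hvc (i : ι) : starRingEnd ℂ (v i) = v i := by simp [hv]
  -- With `D = diag(a)`, `v_i = √w_i` and `g = ⟨v, (z-D)⁻¹ v⟩`, the matrix `A = D + x v vᵀ`
  -- satisfies `⟨v, (z-A)⁻¹ v⟩ = g / (1 - x g) = 1 / (g⁻¹ - x)`. Its eigenvalues and the squared
  -- overlaps with `v` are the atoms and weights.
  set A : Matrix ι ι ℂ := Matrix.diagonal (fun i => (a i : ℂ)) +
    (x : ℂ) • Matrix.vecMulVec (fun i => v i) (fun i => v i) with hA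
  have hH : A.IsHermitian := by
    ext i j
    by_cases hij : i = j
    · subst hij
      simp [hA, Matrix.vecMulVec_apply, hvc]
    · simp [hA, Matrix.vecMulVec_apply, Matrix.diagonal_apply_ne _ hij,
        Matrix.diagonal_apply_ne _ (Ne.symm hij), hvc, mul_comm]
  set b := hH.eigenvectorBasis
  refine ⟨fun j => ‖inner ℂ (b j) v‖ ^ 2, hH.eigenvalues, fun j => by positivity, ?_, ?_⟩
  · rw [b.sum_sq_norm_inner_right, EuclideanSpace.norm_sq_eq, ← hsum]
    refine Finset.sum_congr rfl fun i _ => ?_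
    rw [← norm_pow, pow_two, hvi, Complex.norm_real, Real.norm_of_nonneg (hw i)]
  · intro z hz hg
    set g := ∑ i, (w i : ℂ) * (z - (a i : ℂ))⁻¹ with hgdef
    set u : EuclideanSpace ℂ ι := WithLp.toLp 2 fun i => v i * (z - (a i : ℂ))⁻¹ with hu
    have hvu : inner ℂ v u = g := by
      rw [PiLp.inner_apply]
      refine Finset.sum_congr rfl fun i _ => ?_
      simp only [RCLike.inner_apply, hvc, hu]
      rw [← hvi]
      ring
    -- As `u = (z-D)⁻¹ v`, this says `(z-A)u = (1 - x g) v`; pairing with the eigenvectors then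
    -- avoids inverting `z - A`.
    have hAu (i : ι) : (A.mulVec fun i => u i) i = z * u i - (1 - x * g) * v i := by
      have h1 : ∑ i, v i * u i = g := by
        refine Finset.sum_congr rfl fun i _ => ?_
        simp only [hu]
        rw [← hvi]
        ring
      have h2 := sub_ofReal_ne_zero hz (a i)
      rw [hA, Matrix.add_mulVec, Matrix.smul_mulVec]
      simp only [Pi.add_apply, Matrix.mulVec_diagonal, Pi.smul_apply, Matrix.vecMulVec_mulVec,
        smul_eq_mul, dotProduct, h1, MulOpposite.smul_eq_mul_unop, MulOpposite.unop_op]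
      simp only [hu]
      field_simp
      ring
    have hbj (j : ι) : (z - hH.eigenvalues j) * inner ℂ (b j) u
        = (1 - x * g) * inner ℂ (b j) v := by
      have h1 : (A.mulVec fun i => u i) ⬝ᵥ star (fun i => b j i)
          = hH.eigenvalues j * inner ℂ (b j) u := by
        have h2 : A.mulVec (fun i => b j i) = hH.eigenvalues j • fun i => b j i :=
          hH.mulVec_eigenvectorBasis j
        have h4 : Matrix.vecMul (star fun i => b j i) A = star (A.mulVec fun i => b j i) := by
          rw [Matrix.star_mulVec, hH.eq]
        rw [dotProduct_comm, Matrix.dotProduct_mulVec, h4, h2,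
          EuclideanSpace.inner_eq_star_dotProduct, dotProduct_comm]
        simp [dotProduct, Finset.mul_sum]
        refine Finset.sum_congr rfl fun i _ => by ring
      have h3 : (A.mulVec fun i => u i) ⬝ᵥ star (fun i => b j i)
          = z * inner ℂ (b j) u - (1 - x * g) * inner ℂ (b j) v := by
        rw [funext hAu, EuclideanSpace.inner_eq_star_dotProduct,
          EuclideanSpace.inner_eq_star_dotProduct]
        simp only [dotProduct, Finset.mul_sum, ← Finset.sum_sub_distrib]
        refine Finset.sum_congr rfl fun i _ => ?_
        simp only [Pi.star_apply]
        ring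
      linear_combination h1 - h3
    have hsumg : g = (1 - x * g) * ∑ j, ((‖inner ℂ (b j) v‖ ^ 2 : ℝ) : ℂ) *
        (z - (hH.eigenvalues j : ℂ))⁻¹ := by
      conv_lhs => rw [← hvu, ← b.sum_inner_mul_inner v u]
      rw [Finset.mul_sum]
      refine Finset.sum_congr rfl fun j _ => ?_
      have h2 := sub_ofReal_ne_zero hz (hH.eigenvalues j)
      have h3 : inner ℂ (b j) u = (1 - x * g) * inner ℂ (b j) v *
          (z - (hH.eigenvalues j : ℂ))⁻¹ := by
        rw [← hbj]
        field_simp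
      rw [h3, ← inner_conj_symm v (b j), Complex.ofReal_pow, ← Complex.conj_mul']
      ring
    have hne : 1 - x * g ≠ 0 := fun h => hg (by rw [hsumg, h, zero_mul])
    have : (g⁻¹ - x)⁻¹ = g / (1 - x * g) := by
      rw [← inv_div]
      congr 1
      field_simp
    rw [this, eq_div_iff hne, mul_comm]
    exact hsumg.symm


/-- The discrete measures are the images of `μ` under simple functions converging pointwise to the
identity. -/
theorem exists_discretization (μ : ProbabilityMeasure ℝ) :
    ∃ (s : ℕ → Finset ℝ) (w : (n : ℕ) → s n → ℝ), (∀ n i, 0 ≤ w n i) ∧ (∀ n, ∑ i, w n i = 1) ∧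
      ∀ z : ℂ, z.im ≠ 0 → Tendsto (fun n => ∑ i : s n, (w n i : ℂ) * (z - ((i : ℝ) : ℂ))⁻¹) atTop
        (𝓝 (cauchyTransform μ z)) := by
  let φ : ℕ → SimpleFunc ℝ ℝ := SimpleFunc.approxOn id measurable_id Set.univ 0 (Set.mem_univ 0)
  have hφ (x : ℝ) : Tendsto (fun n => φ n x) atTop (𝓝 x) :=
    SimpleFunc.tendsto_approxOn measurable_id (Set.mem_univ 0) (by simp)
  have key (n : ℕ) (g : ℝ → ℂ) : ∫ x, g (φ n x) ∂(μ : Measure ℝ)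
      = ∑ i : (φ n).range, ((μ : Measure ℝ).real (φ n ⁻¹' {(i : ℝ)}) : ℂ) * g i := by
    have h1 : ∀ x, g (φ n x)
        = ∑ i ∈ (φ n).range, (φ n ⁻¹' {i}).indicator (fun _ => g i) x := by
      intro x
      rw [Finset.sum_eq_single (φ n x)]
      · simp
      · intro i _ hi
        simp [Ne.symm hi]
      · intro h
        exact absurd (SimpleFunc.mem_range_self _ x) h
    simp_rw [h1]
    rw [integral_finsetSum _ fun i _ =>
      (integrable_const _).indicator ((φ n).measurableSet_preimage {i}), ← Finset.sum_coe_sort]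
    refine Finset.sum_congr rfl fun i _ => ?_
    rw [integral_indicator_const _ ((φ n).measurableSet_preimage {(i : ℝ)}), Complex.real_smul]
  refine ⟨fun n => (φ n).range, fun n i => (μ : Measure ℝ).real (φ n ⁻¹' {(i : ℝ)}),
    fun n i => measureReal_nonneg, fun n => ?_, fun z hz => ?_⟩
  · have := key n fun _ => 1
    simp only [mul_one, integral_const, probReal_univ, one_smul] at this
    exact_mod_cast this.symm
  · simp_rw [← key _ fun x => (z - (x : ℂ))⁻¹]
    refine tendsto_integral_of_dominated_convergence (fun _ => |z.im|⁻¹) (fun n => ?_)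
      (integrable_const _) (fun n => Eventually.of_forall fun x => norm_inv_sub_ofReal_le_abs hz _)
      (Eventually.of_forall fun x => ?_)
    · exact ((continuous_inv_sub_ofReal hz).measurable.comp (φ n).measurable).aestronglyMeasurable
    · exact ((continuous_inv_sub_ofReal hz).tendsto x).comp (hφ x)

theorem recipCauchy_im_pos (ν : ProbabilityMeasure ℝ) {z : ℂ} (hz : 0 < z.im) :
    0 < (recipCauchy ν z).im :=
  hz.trans_le (im_le_im_recipCauchy ν hz)

/-- What needs checking is the normalisation at `i∞`. It holds because `H_ν(iy)` tends to infinity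
inside a cone: its norm is at most `2y`, while its imaginary part is at least `y`. -/
theorem exists_of_tendsto_comp {μ ν : ProbabilityMeasure ℝ} {ρ : ℕ → ProbabilityMeasure ℝ}
    (h : ∀ z : ℂ, 0 < z.im → Tendsto (fun n => cauchyTransform (ρ n) z) atTop
      (𝓝 (cauchyTransform μ (recipCauchy ν z)))) :
    ∃ σ : ProbabilityMeasure ℝ, ∀ z : ℂ, 0 < z.im →
      cauchyTransform σ z = cauchyTransform μ (recipCauchy ν z) := by
  refine exists_cauchyTransform_eq (F := fun z => cauchyTransform μ (recipCauchy ν z)) le_rfl h ?_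
  have hν := tendsto_mul_cauchyTransform_I ν
  have him : Tendsto (fun y : ℝ => (recipCauchy ν (y * Complex.I)).im) atTop atTop := by
    refine tendsto_atTop_mono' _ ?_ tendsto_id
    filter_upwards [eventually_gt_atTop 0] with y hy
    simpa using im_le_im_recipCauchy ν (z := y * Complex.I) (by simpa using hy)
  have hC : ∀ᶠ y : ℝ in atTop,
      ‖recipCauchy ν (y * Complex.I)‖ ≤ 2 * (recipCauchy ν (y * Complex.I)).im := by
    have h2 := (hν.inv₀ one_ne_zero).norm
    simp only [inv_one, norm_one] at h2
    filter_upwards [eventually_gt_atTop 0, h2.eventually_le_const one_lt_two] with y hy hle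
    have h3 : ‖recipCauchy ν (y * Complex.I)‖ ≤ 2 * y := by
      rw [mul_inv, norm_mul, norm_inv, norm_mul, Complex.norm_I, Complex.norm_real,
        Real.norm_of_nonneg hy.le, mul_one, inv_mul_le_iff₀ hy] at hle
      rw [recipCauchy]
      linarith
    have h4 := im_le_im_recipCauchy ν (z := y * Complex.I) (by simpa using hy)
    simp only [Complex.mul_I_im, Complex.ofReal_re] at h4
    linarith
  have hμ := (tendsto_mul_cauchyTransform μ him hC).mul hν
  rw [one_mul] at hμ
  refine hμ.congr' ?_
  filter_upwards [eventually_gt_atTop 0] with y hy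
  have h5 := cauchyTransform_ne_zero ν (z := y * Complex.I) (by simpa using hy)
  rw [recipCauchy]
  field_simp

/-- The required measure is the mixture, with weights `q j`, of the rank one perturbations of `ν` of
strength `c j`. -/
theorem exists_comp_of_sum {ι κ : Type*} [Fintype ι] [Fintype κ] [DecidableEq κ]
    {μ ν : ProbabilityMeasure ℝ} (q c : ι → ℝ) (hq : ∀ i, 0 ≤ q i) (hqs : ∑ i, q i = 1)
    (w a : κ → ℝ) (hw : ∀ i, 0 ≤ w i) (hws : ∑ i, w i = 1)
    (hμ : ∀ z, cauchyTransform μ z = ∑ i, (q i : ℂ) * (z - (c i : ℂ))⁻¹)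
    (hν : ∀ z, cauchyTransform ν z = ∑ i, (w i : ℂ) * (z - (a i : ℂ))⁻¹) :
    ∃ σ : ProbabilityMeasure ℝ, ∀ z : ℂ, 0 < z.im →
      cauchyTransform σ z = cauchyTransform μ (recipCauchy ν z) := by
  choose p k hp hps hpk using fun j => exists_rank_one_perturbation a w hw hws (c j)
  obtain ⟨σ, hσ⟩ := exists_cauchyTransform_eq_sum (fun ij : ι × κ => q ij.1 * p ij.1 ij.2)
    (fun ij => k ij.1 ij.2) (fun ij => mul_nonneg (hq _) (hp _ _))
    (by simp [Fintype.sum_prod_type, ← Finset.mul_sum, hps, hqs])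
  refine ⟨σ, fun z hz => ?_⟩
  rw [hσ, hμ, Fintype.sum_prod_type]
  refine Finset.sum_congr rfl fun j _ => ?_
  have hG := cauchyTransform_ne_zero ν hz
  rw [hν] at hG
  rw [recipCauchy, hν, ← hpk j z hz.ne' hG, Finset.mul_sum]
  refine Finset.sum_congr rfl fun i _ => ?_
  push_cast
  ring

theorem exists_cauchyTransform_comp (μ ν : ProbabilityMeasure ℝ) :
    ∃ σ : ProbabilityMeasure ℝ, ∀ z : ℂ, 0 < z.im →
      cauchyTransform σ z = cauchyTransform μ (recipCauchy ν z) := by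
  obtain ⟨s, q, hq, hqs, hqt⟩ := exists_discretization μ
  obtain ⟨t, w, hw, hws, hwt⟩ := exists_discretization ν
  choose μ' hμ' using fun n => exists_cauchyTransform_eq_sum (q n) (fun i => (i : ℝ)) (hq n) (hqs n)
  choose ν' hν' using fun n => exists_cauchyTransform_eq_sum (w n) (fun i => (i : ℝ)) (hw n) (hws n)
  have h1 (m : ℕ) : ∃ σ : ProbabilityMeasure ℝ, ∀ z : ℂ, 0 < z.im →
      cauchyTransform σ z = cauchyTransform (μ' m) (recipCauchy ν z) := by
    choose ρ hρ using fun n => exists_comp_of_sum (q m) (fun i => (i : ℝ)) (hq m) (hqs m) (w n)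
      (fun i => (i : ℝ)) (hw n) (hws n) (hμ' m) (hν' n)
    refine exists_of_tendsto_comp (ρ := ρ) fun z hz => ?_
    simp_rw [hρ _ z hz]
    -- The inner limit, in `ν`, uses continuity of the Cauchy transform of the discretized `μ`. The
    -- outer limit, in `μ`, takes place at the fixed point `H_ν(z)`.
    refine (hasDerivAt_cauchyTransform (μ' m)
      (recipCauchy_im_pos ν hz)).continuousAt.tendsto.comp ?_
    refine Tendsto.inv₀ ?_ (cauchyTransform_ne_zero ν hz)
    simpa only [hν'] using hwt z hz.ne'
  choose ρ hρ using h1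
  refine exists_of_tendsto_comp (ρ := ρ) fun z hz => ?_
  simp_rw [hρ _ z hz, hμ']
  exact hqt _ (recipCauchy_im_pos ν hz).ne'

/-- The lower half-plane carries no extra information, since `H` commutes with conjugation. -/
theorem isMonotoneConv_iff {μ ν ρ : ProbabilityMeasure ℝ} :
    IsMonotoneConv μ ν ρ ↔
      ∀ z : ℂ, 0 < z.im → cauchyTransform ρ z = cauchyTransform μ (recipCauchy ν z) := by
  constructor
  · intro h z hz
    exact inv_injective (h z hz.ne')
  · intro h z hz
    rcases lt_or_gt_of_ne hz with hz | hz
    · have hz' : 0 < (starRingEnd ℂ z).im := by simpa using hz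
      have := congrArg (starRingEnd ℂ) (congrArg (·⁻¹) (h _ hz'))
      change starRingEnd ℂ (recipCauchy ρ _) = starRingEnd ℂ (recipCauchy μ _) at this
      simpa only [← recipCauchy_conj, Complex.conj_conj] using this
    · exact congrArg (·⁻¹) (h z hz)

theorem existsUnique_isMonotoneConv (μ ν : ProbabilityMeasure ℝ) :
    ∃! ρ : ProbabilityMeasure ℝ, IsMonotoneConv μ ν ρ := by
  obtain ⟨ρ, hρ⟩ := exists_cauchyTransform_comp μ ν
  refine ⟨ρ, isMonotoneConv_iff.2 hρ, fun σ hσ => ?_⟩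
  refine eq_of_cauchyTransform_eq fun z hz => ?_
  rw [hρ z hz, isMonotoneConv_iff.1 hσ z hz]

theorem isMonotoneConv_monotoneConv (μ ν : ProbabilityMeasure ℝ) :
    IsMonotoneConv μ ν (monotoneConv μ ν) :=
  Classical.epsilon_spec (existsUnique_isMonotoneConv μ ν).exists

/-! ### Convolution powers as iterates of `H`. -/

theorem cauchyTransform_monotoneConvPow (μ : ProbabilityMeasure ℝ) (n : ℕ) {z : ℂ}
    (hz : 0 < z.im) :
    cauchyTransform (monotoneConvPow μ n) z = ((recipCauchy μ)^[n] z)⁻¹ := by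
  have h (n : ℕ) : ∀ z : ℂ, 0 < z.im →
      cauchyTransform (monotoneConvPow μ (n + 1)) z = ((recipCauchy μ)^[n + 1] z)⁻¹ := by
    induction n with
    | zero => intro z _; simp [monotoneConvPow, recipCauchy]
    | succ n ih =>
      intro z hz
      rw [monotoneConvPow, isMonotoneConv_iff.1 (isMonotoneConv_monotoneConv _ _) z hz,
        ih _ (recipCauchy_im_pos μ hz), Function.iterate_succ_apply _ (n + 1)]
  cases n with
  | zero => simp [monotoneConvPow, cauchyTransform]
  | succ n => exact h n z hz

theorem im_le_im_iterate_recipCauchy (μ : ProbabilityMeasure ℝ) (n : ℕ) {z : ℂ}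
    (hz : 0 < z.im) : z.im ≤ ((recipCauchy μ)^[n] z).im := by
  induction n with
  | zero => simp
  | succ n ih =>
    rw [Function.iterate_succ_apply']
    exact ih.trans (im_le_im_recipCauchy μ (hz.trans_le ih))

/-! ### The central limit theorem: iteration in the squared coordinate. -/

theorem integrable_complex_ofReal {μ : ProbabilityMeasure ℝ} {f : ℝ → ℝ}
    (hf : Integrable f (μ : Measure ℝ)) : Integrable (fun x : ℝ => (f x : ℂ)) (μ : Measure ℝ) :=
  hf.ofReal

theorem integrable_mul_inv_sub {μ : ProbabilityMeasure ℝ} {f : ℝ → ℝ}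
    (hf : Integrable f (μ : Measure ℝ)) {w : ℂ} (hw : 0 < w.im) :
    Integrable (fun x : ℝ => (f x : ℂ) * (w - x)⁻¹) (μ : Measure ℝ) :=
  hf.ofReal.mul_bdd (c := w.im⁻¹) (continuous_inv_sub_ofReal hw.ne').aestronglyMeasurable
    (Eventually.of_forall fun x => norm_inv_sub_ofReal_le hw x)

theorem norm_integral_mul_inv_sub_le {μ : ProbabilityMeasure ℝ} {f : ℝ → ℝ}
    (hf : Integrable f (μ : Measure ℝ)) {w : ℂ} (hw : 0 < w.im) :
    ‖∫ x : ℝ, (f x : ℂ) * (w - x)⁻¹ ∂(μ : Measure ℝ)‖ ≤ (∫ x, |f x| ∂(μ : Measure ℝ)) / w.im := by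
  refine (norm_integral_le_integral_norm _).trans ?_
  rw [div_eq_mul_inv, ← integral_mul_const]
  refine integral_mono (integrable_mul_inv_sub hf hw).norm (hf.abs.mul_const _) fun x => ?_
  simp only [norm_mul, Complex.norm_real, Real.norm_eq_abs]
  gcongr
  exact norm_inv_sub_ofReal_le hw x

/-- Expansion of the Cauchy transform to second order. -/
theorem recipCauchy_mul_add {μ : ProbabilityMeasure ℝ} (hμ : HasAllMoments μ) {w : ℂ}
    (hw : 0 < w.im) :
    recipCauchy μ w * (w + (moment μ 1 +
      ∫ x : ℝ, ((x ^ 2 : ℝ) : ℂ) * (w - x)⁻¹ ∂(μ : Measure ℝ))) = w ^ 2 := by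
  have hw0 : w ≠ 0 := fun h => by simp [h] at hw
  have h1 : w ^ 2 * cauchyTransform μ w = w + (moment μ 1 +
      ∫ x : ℝ, ((x ^ 2 : ℝ) : ℂ) * (w - x)⁻¹ ∂(μ : Measure ℝ)) := by
    have hm : (moment μ 1 : ℂ) = ∫ x : ℝ, ((x ^ 1 : ℝ) : ℂ) ∂(μ : Measure ℝ) :=
      integral_ofReal.symm
    have h0 : w = ∫ _x : ℝ, w ∂(μ : Measure ℝ) := by simp
    rw [hm, ← integral_add (integrable_complex_ofReal (hμ 1)) (integrable_mul_inv_sub (hμ 2) hw)]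
    have hI : Integrable (fun x : ℝ => ((x ^ 1 : ℝ) : ℂ) + ((x ^ 2 : ℝ) : ℂ) * (w - x)⁻¹)
        (μ : Measure ℝ) := (integrable_complex_ofReal (hμ 1)).add (integrable_mul_inv_sub (hμ 2) hw)
    conv_rhs => enter [1]; rw [h0]
    rw [← integral_add (integrable_const _) hI, cauchyTransform, ← integral_const_mul]
    refine integral_congr_ae (Eventually.of_forall fun x => ?_)
    have := sub_ofReal_ne_zero hw.ne' x
    push_cast
    field_simp
    ring
  rw [← h1, recipCauchy]
  have := cauchyTransform_ne_zero μ hw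
  field_simp

/-- With `B = ∫ x²/(w-x) dμ` and `q = B/w`, one has `H(w) = w/(1+q)`, so `H(w)² = w² - 2Bw + …`, and
`Bw` differs from `M_2` by a third-moment term. Squaring makes the displacement nearly independent
of `w`. -/
theorem norm_recipCauchy_sq_sub_le {μ : ProbabilityMeasure ℝ} (hμ : HasAllMoments μ)
    (h1 : moment μ 1 = 0) {δ : ℝ} (hδ : 0 < δ) (hsmall : 2 * moment μ 2 ≤ δ ^ 2) {w : ℂ}
    (hw : δ ≤ w.im) :
    ‖recipCauchy μ w ^ 2 - w ^ 2 + 2 * moment μ 2‖ ≤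
      2 * (∫ x, |x ^ 3| ∂(μ : Measure ℝ)) / δ + 16 * (moment μ 2) ^ 2 / δ ^ 2 := by
  have hw' := hδ.trans_le hw
  have hw0 : w ≠ 0 := fun h => by simp [h] at hw'
  have hwn : δ ≤ ‖w‖ := hw.trans ((le_abs_self _).trans (Complex.abs_im_le_norm w))
  have hH := recipCauchy_mul_add hμ hw'
  set B := ∫ x : ℝ, ((x ^ 2 : ℝ) : ℂ) * (w - x)⁻¹ ∂(μ : Measure ℝ) with hB
  rw [h1, Complex.ofReal_zero, zero_add] at hH
  have hv0 : 0 ≤ moment μ 2 := integral_nonneg fun x => sq_nonneg x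
  have hBle : ‖B‖ ≤ moment μ 2 / δ := by
    refine (norm_integral_mul_inv_sub_le (hμ 2) hw').trans ?_
    simp only [abs_sq]
    exact div_le_div_of_nonneg_left hv0 hδ hw
  have hBw : ‖(moment μ 2 : ℂ) - B * w‖ ≤ (∫ x, |x ^ 3| ∂(μ : Measure ℝ)) / δ := by
    have hm : (moment μ 2 : ℂ) = ∫ x : ℝ, ((x ^ 2 : ℝ) : ℂ) ∂(μ : Measure ℝ) :=
      integral_ofReal.symm
    have : (moment μ 2 : ℂ) - B * w
        = -∫ x : ℝ, ((x ^ 3 : ℝ) : ℂ) * (w - x)⁻¹ ∂(μ : Measure ℝ) := by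
      rw [hm, hB, ← integral_mul_const, ← integral_sub (integrable_complex_ofReal (hμ 2))
        ((integrable_mul_inv_sub (hμ 2) hw').mul_const _), ← integral_neg]
      refine integral_congr_ae (Eventually.of_forall fun x => ?_)
      have := sub_ofReal_ne_zero hw'.ne' x
      push_cast
      field_simp
      ring
    rw [this, norm_neg]
    refine (norm_integral_mul_inv_sub_le (hμ 3) hw').trans ?_
    exact div_le_div_of_nonneg_left (integral_nonneg fun x => abs_nonneg _) hδ hw
  set q := B / w with hq
  have hqn : ‖q‖ ≤ 1 / 2 := by
    rw [hq, norm_div, div_le_iff₀ (hδ.trans_le hwn)]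
    calc ‖B‖ ≤ moment μ 2 / δ := hBle
      _ ≤ 1 / 2 * δ := by rw [div_le_iff₀ hδ]; nlinarith
      _ ≤ 1 / 2 * ‖w‖ := by gcongr
  have hq1 : 1 / 2 ≤ ‖1 + q‖ := by
    have := norm_sub_norm_le (1 : ℂ) (-q)
    rw [norm_one, norm_neg, sub_neg_eq_add] at this
    linarith
  have hq0 : 1 + q ≠ 0 := fun h => by
    rw [h, norm_zero] at hq1
    linarith
  have hBq : B = q * w := by rw [hq]; field_simp
  have hHq : recipCauchy μ w = w / (1 + q) := by
    rw [eq_div_iff hq0]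
    have : w * (recipCauchy μ w * (1 + q)) = w * w := by
      rw [hBq] at hH
      linear_combination hH
    exact mul_left_cancel₀ hw0 this
  -- This uses `(1+q)⁻² = 1 - 2q + q²(3+2q)/(1+q)²` and `B = q w`.
  have hid : recipCauchy μ w ^ 2 - w ^ 2 + 2 * moment μ 2
      = 2 * (moment μ 2 - B * w) + B ^ 2 * (3 + 2 * q) / (1 + q) ^ 2 := by
    rw [hHq, hBq]
    field_simp
    ring
  rw [hid]
  have h3 : ‖3 + 2 * q‖ ≤ 4 := by
    refine (norm_add_le _ _).trans ?_
    rw [norm_mul, Complex.norm_ofNat, Complex.norm_ofNat]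
    linarith
  refine (norm_add_le _ _).trans (add_le_add ?_ ?_)
  · rw [norm_mul, Complex.norm_ofNat, mul_div_assoc]
    gcongr
  · rw [norm_div, norm_mul, norm_pow, norm_pow]
    calc ‖B‖ ^ 2 * ‖3 + 2 * q‖ / ‖1 + q‖ ^ 2
        ≤ (moment μ 2 / δ) ^ 2 * 4 / (1 / 2) ^ 2 := by gcongr
      _ = _ := by ring

theorem hasAllMoments_dilation {μ : ProbabilityMeasure ℝ} (hμ : HasAllMoments μ) (c : ℝ) :
    HasAllMoments (dilation c μ) := by
  intro k
  rw [dilation, ProbabilityMeasure.toMeasure_map,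
    integrable_map_measure (by fun_prop) (by fun_prop)]
  simp only [Function.comp_def, mul_pow]
  exact (hμ k).const_mul _

theorem integral_dilation {μ : ProbabilityMeasure ℝ} (c : ℝ) {f : ℝ → ℝ} (hf : Continuous f) :
    ∫ x, f x ∂(dilation c μ : Measure ℝ) = ∫ x, f (c * x) ∂(μ : Measure ℝ) := by
  rw [dilation, ProbabilityMeasure.toMeasure_map,
    integral_map (by fun_prop) hf.aestronglyMeasurable]

theorem moment_dilation (μ : ProbabilityMeasure ℝ) (c : ℝ) (k : ℕ) :
    moment (dilation c μ) k = c ^ k * moment μ k := by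
  rw [moment, integral_dilation c (by fun_prop), moment, ← integral_const_mul]
  simp only [mul_pow]

/-- Each step errs by `O(N^{-3/2})`, coming from the third absolute moment, plus `O(N⁻²)`, coming
from the squared variance. The bounds are uniform because all iterates keep imaginary part at least
`Im z`, so the `N` errors add up to `o(1)`. -/
theorem tendsto_iterate_recipCauchy_dilation {μ : ProbabilityMeasure ℝ} (hμ : HasAllMoments μ)
    (h1 : moment μ 1 = 0) (h2 : moment μ 2 = 1) {z : ℂ} (hz : 0 < z.im) :
    Tendsto (fun N : ℕ => ((recipCauchy (dilation (1 / √(N : ℝ)) μ))^[N] z) ^ 2) atTop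
      (𝓝 (z ^ 2 - 2)) := by
  set T := ∫ x, |x ^ 3| ∂(μ : Measure ℝ) with hT
  set δ := z.im with hδ
  have hbound : ∀ᶠ N : ℕ in atTop,
      ‖((recipCauchy (dilation (1 / √(N : ℝ)) μ))^[N] z) ^ 2 - (z ^ 2 - 2)‖ ≤
        2 * T / δ * (√(N : ℝ))⁻¹ + 16 / δ ^ 2 * (N : ℝ)⁻¹ := by
    have hlarge : ∀ᶠ N : ℕ in atTop, 2 / δ ^ 2 ≤ (N : ℝ) :=
      tendsto_natCast_atTop_atTop.eventually_ge_atTop _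
    filter_upwards [eventually_gt_atTop 0, hlarge] with N hN hNl
    have hN' : (0 : ℝ) < N := by exact_mod_cast hN
    have hs : √(N : ℝ) ^ 2 = N := Real.sq_sqrt hN'.le
    have hs0 : 0 < √(N : ℝ) := Real.sqrt_pos.2 hN'
    set ρ := dilation (1 / √(N : ℝ)) μ with hρ
    have hm1 : moment ρ 1 = 0 := by rw [hρ, moment_dilation, h1, mul_zero]
    have hm2 : moment ρ 2 = (N : ℝ)⁻¹ := by
      rw [hρ, moment_dilation, h2, mul_one, div_pow, hs, one_pow, one_div]
    have hm3 : ∫ x, |x ^ 3| ∂(ρ : Measure ℝ) = (√(N : ℝ))⁻¹ * (N : ℝ)⁻¹ * T := by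
      rw [hρ, integral_dilation _ (by fun_prop), hT, ← integral_const_mul]
      refine integral_congr_ae (Eventually.of_forall fun x => ?_)
      simp only [mul_pow, abs_mul]
      rw [abs_of_nonneg (by positivity : (0 : ℝ) ≤ (1 / √(N : ℝ)) ^ 3),
        show (N : ℝ)⁻¹ = (√(N : ℝ) ^ 2)⁻¹ by rw [hs]]
      congr 1
      field_simp
    have hstep (k : ℕ) : ‖((recipCauchy ρ)^[k] z) ^ 2 - (z ^ 2 - 2 * (k * (N : ℝ)⁻¹ : ℝ))‖ ≤
        k * (2 * ((√(N : ℝ))⁻¹ * (N : ℝ)⁻¹ * T) / δ + 16 * ((N : ℝ)⁻¹) ^ 2 / δ ^ 2) := by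
      induction k with
      | zero => simp
      | succ k ih =>
        have hk := norm_recipCauchy_sq_sub_le (hasAllMoments_dilation hμ _) hm1 hz
          (by
            rw [← hρ, hm2, ← div_eq_mul_inv, div_le_iff₀ hN']
            rwa [div_le_iff₀ (by positivity), mul_comm] at hNl)
          (im_le_im_iterate_recipCauchy ρ k hz)
        rw [← hρ, hm2, hm3] at hk
        rw [Function.iterate_succ_apply']
        have := (norm_add_le _ _).trans (add_le_add hk ih)
        calc _ = _ := by
              congr 1
              push_cast
              ring
          _ ≤ _ := this
          _ = _ := by
              push_cast
              ring
    have := hstep N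
    rw [mul_inv_cancel₀ hN'.ne', Complex.ofReal_one, mul_one] at this
    refine this.trans_eq ?_
    field_simp
  rw [tendsto_iff_norm_sub_tendsto_zero]
  refine squeeze_zero' (Eventually.of_forall fun _ => norm_nonneg _) hbound ?_
  have h3 : Tendsto (fun N : ℕ => (N : ℝ)⁻¹) atTop (𝓝 0) := tendsto_inv_atTop_nhds_zero_nat
  have h4 : Tendsto (fun N : ℕ => (√(N : ℝ))⁻¹) atTop (𝓝 0) :=
    tendsto_inv_atTop_zero.comp (Real.tendsto_sqrt_atTop.comp tendsto_natCast_atTop_atTop)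
  simpa using (h4.const_mul (2 * T / δ)).add (h3.const_mul (16 / δ ^ 2))

/-! ### The Cauchy transform of the arcsine law. -/

theorem integral_arcsineLaw (f : ℝ → ℂ) :
    ∫ x, f x ∂(arcsineLaw : Measure ℝ) = ∫ x in Set.Ioo (-√2) √2, (arcsineDensity x : ℂ) * f x := by
  change ∫ x, f x ∂arcsineMeasure = _
  rw [arcsineMeasure, integral_withDensity_eq_integral_toReal_smul
    (by unfold arcsineDensity; fun_prop) (Eventually.of_forall fun _ => by simp)]
  refine integral_congr_ae (Eventually.of_forall fun x => ?_)
  simp [ENNReal.toReal_ofReal (arcsineDensity_nonneg x)]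

theorem integrable_arcsineLaw_iff (f : ℝ → ℂ) : Integrable f (arcsineLaw : Measure ℝ) ↔
    IntegrableOn (fun x => (arcsineDensity x : ℂ) * f x) (Set.Ioo (-√2) √2) := by
  change Integrable f arcsineMeasure ↔ _
  rw [arcsineMeasure, integrable_withDensity_iff_integrable_smul'
    (by unfold arcsineDensity; fun_prop) (Eventually.of_forall fun _ => by simp)]
  simp only [IntegrableOn, ENNReal.toReal_ofReal (arcsineDensity_nonneg _), Complex.real_smul]

theorem hasDerivAt_sqrt_mul_inv_sub {z : ℂ} (hz : 0 < z.im) {x : ℝ}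
    (hx : x ∈ Set.Ioo (-√2) √2) :
    HasDerivAt (fun x : ℝ => ((√(2 - x ^ 2) / Real.pi : ℝ) : ℂ) * (z - x)⁻¹)
      ((arcsineDensity x : ℂ) * ((2 - z * x) * ((z - x) ^ 2)⁻¹)) x := by
  have hpos : 0 < 2 - x ^ 2 := by
    have := abs_lt.2 ⟨hx.1, hx.2⟩
    have h2 := sq_lt_sq' hx.1 hx.2
    rw [Real.sq_sqrt (by norm_num)] at h2
    linarith
  have hs : (√(2 - x ^ 2) : ℝ) ≠ 0 := (Real.sqrt_pos.2 hpos).ne'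
  have h1 : HasDerivAt (fun x : ℝ => √(2 - x ^ 2) / Real.pi)
      (-(2 * x) / (2 * √(2 - x ^ 2)) / Real.pi) x := by
    have := ((((hasDerivAt_id x).pow 2).const_sub 2).sqrt hpos.ne').div_const Real.pi
    simpa using this
  have h2 : HasDerivAt (fun x : ℝ => (z - (x : ℂ))⁻¹) (((z - x) ^ 2)⁻¹) x := by
    have := ((hasDerivAt_id x).ofReal_comp.const_sub z).fun_inv
      (sub_ofReal_ne_zero hz.ne' x)
    refine this.congr_deriv ?_
    simp [div_eq_mul_inv]
  refine (h1.ofReal_comp.mul h2).congr_deriv ?_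
  have h3 := sub_ofReal_ne_zero hz.ne' x
  have hs' : ((√(2 - x ^ 2) : ℝ) : ℂ) ≠ 0 := by exact_mod_cast hs
  have hs2 : ((√(2 - x ^ 2) : ℝ) : ℂ) ^ 2 = 2 - (x : ℂ) ^ 2 := by
    rw [← Complex.ofReal_pow, Real.sq_sqrt hpos.le]
    push_cast
    rfl
  have hpi : (Real.pi : ℂ) ≠ 0 := by exact_mod_cast Real.pi_ne_zero
  unfold arcsineDensity
  push_cast
  field_simp
  rw [hs2]
  ring

/-- The combined integrand, density included, is the `x`-derivative of `√(2-x²) / (π(z-x))`, which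
vanishes at both endpoints. -/
theorem arcsineLaw_ode {z : ℂ} (hz : 0 < z.im) :
    (z ^ 2 - 2) * deriv (cauchyTransform arcsineLaw) z + z * cauchyTransform arcsineLaw z = 0 := by
  rw [(hasDerivAt_cauchyTransform arcsineLaw hz).deriv, cauchyTransform]
  have hle : -√2 ≤ √2 := by linarith [Real.sqrt_nonneg 2]
  have hi1 := integrable_inv_sub_ofReal arcsineLaw hz.ne'
  have hi2 : Integrable (fun x : ℝ => -((z - (x : ℂ)) ^ 2)⁻¹) (arcsineLaw : Measure ℝ) := by
    refine Integrable.of_bound (C := (z.im⁻¹) ^ 2)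
      (((continuous_const.sub Complex.continuous_ofReal).pow 2).inv₀ fun x =>
      pow_ne_zero 2 (sub_ofReal_ne_zero hz.ne' x)).neg.aestronglyMeasurable
      (Eventually.of_forall fun x => ?_)
    rw [norm_neg, ← inv_pow, norm_pow]
    gcongr
    exact norm_inv_sub_ofReal_le hz x
  have hadd := (hi2.const_mul (z ^ 2 - 2)).add (hi1.const_mul z)
  rw [← integral_const_mul, ← integral_const_mul,
    ← integral_add (hi2.const_mul (z ^ 2 - 2)) (hi1.const_mul z)]
  have hfun : (fun x : ℝ => (z ^ 2 - 2) * -((z - (x : ℂ)) ^ 2)⁻¹ + z * (z - (x : ℂ))⁻¹)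
      = fun x : ℝ => (2 - z * x) * ((z - x) ^ 2)⁻¹ := by
    ext x
    have := sub_ofReal_ne_zero hz.ne' x
    field_simp
    ring
  have hadd' : Integrable (fun x : ℝ => (2 - z * x) * ((z - (x : ℂ)) ^ 2)⁻¹)
      (arcsineLaw : Measure ℝ) := by
    rw [← hfun]
    exact hadd
  rw [hfun, integral_arcsineLaw]
  rw [integrable_arcsineLaw_iff] at hadd'
  rw [← integral_Ioc_eq_integral_Ioo, ← intervalIntegral.integral_of_le hle,
    intervalIntegral.integral_eq_sub_of_hasDerivAt_of_le hle ?_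
      (fun x hx => hasDerivAt_sqrt_mul_inv_sub hz hx) ?_]
  · simp
  · refine Continuous.continuousOn (Continuous.mul ?_ (continuous_inv_sub_ofReal hz.ne'))
    fun_prop
  · rw [intervalIntegrable_iff_integrableOn_Ioo_of_le hle]
    exact hadd'

/-- The differential equation makes the left side constant on the half-plane, and letting `z = iy →
i∞` fixes the constant. No branch of the square root is chosen. -/
theorem cauchyTransform_arcsineLaw_sq {z : ℂ} (hz : 0 < z.im) :
    cauchyTransform arcsineLaw z ^ 2 * (z ^ 2 - 2) = 1 := by
  set f : ℂ → ℂ := fun z => cauchyTransform arcsineLaw z ^ 2 * (z ^ 2 - 2) with hf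
  have hU : IsOpen {z : ℂ | 0 < z.im} := isOpen_lt continuous_const Complex.continuous_im
  have hd (w : ℂ) (hw : 0 < w.im) : HasDerivAt f 0 w := by
    have hG := (hasDerivAt_cauchyTransform arcsineLaw hw).differentiableAt.hasDerivAt
    refine ((hG.pow 2).mul (((hasDerivAt_id w).pow 2).sub_const 2)).congr_deriv ?_
    have := arcsineLaw_ode hw
    simp only [id, Pi.pow_apply]
    push_cast
    linear_combination 2 * cauchyTransform arcsineLaw w * this
  have hconst (y : ℝ) (hy : 0 < y) : f z = f (y * Complex.I) :=
    hU.is_const_of_deriv_eq_zero (convex_halfSpace_im_gt 0).isPreconnected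
      (fun w hw => (hd w hw).differentiableAt.differentiableWithinAt)
      (fun w hw => (hd w hw).deriv) hz (by show 0 < (y * Complex.I).im; simpa using hy)
  have h1 := (tendsto_mul_cauchyTransform_I arcsineLaw).pow 2
  have h0 : Tendsto (fun y : ℝ => ((y⁻¹ : ℝ) : ℂ)) atTop (𝓝 ((0 : ℝ) : ℂ)) :=
    (Complex.continuous_ofReal.tendsto 0).comp tendsto_inv_atTop_zero
  have h2 := h1.mul (((h0.pow 2).const_mul 2).const_add 1)
  have h3 : Tendsto (fun y : ℝ => f (y * Complex.I)) atTop (𝓝 1) := by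
    refine (h2.congr' ?_).trans (by simp)
    filter_upwards [eventually_gt_atTop 0] with y hy
    have hy' : (y : ℂ) ≠ 0 := by exact_mod_cast hy.ne'
    simp only [hf, mul_pow, Complex.I_sq]
    push_cast
    field_simp
    ring
  refine tendsto_nhds_unique (tendsto_const_nhds.congr' ?_) h3
  filter_upwards [eventually_gt_atTop 0] with y hy using hconst y hy

/-- Convergence of squares gives convergence: the iterate `w` and the limit `h` both lie in the
upper half-plane, so `|w + h| ≥ Im h` and `|w - h| ≤ |w² - h²| / Im h`. -/
theorem tendsto_arcsineLaw {μ : ProbabilityMeasure ℝ} (hμ : HasAllMoments μ)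
    (h1 : moment μ 1 = 0) (h2 : moment μ 2 = 1) :
    Tendsto (fun N : ℕ => monotoneConvPow (dilation (1 / √(N : ℝ)) μ) N) atTop
      (𝓝 arcsineLaw) := by
  refine tendsto_of_tendsto_cauchyTransform le_rfl fun z hz => ?_
  simp_rw [cauchyTransform_monotoneConvPow _ _ hz]
  have hG0 := cauchyTransform_ne_zero arcsineLaw hz
  rw [← inv_inv (cauchyTransform arcsineLaw z)]
  refine Tendsto.inv₀ ?_ (inv_ne_zero hG0)
  set h := (cauchyTransform arcsineLaw z)⁻¹ with hh
  have him : 0 < h.im := recipCauchy_im_pos arcsineLaw hz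
  have hsq : h ^ 2 = z ^ 2 - 2 := by
    have := cauchyTransform_arcsineLaw_sq hz
    rw [hh]
    field_simp
    linear_combination -this
  have ht := tendsto_iterate_recipCauchy_dilation hμ h1 h2 hz
  rw [← hsq, tendsto_iff_norm_sub_tendsto_zero] at ht
  rw [tendsto_iff_norm_sub_tendsto_zero]
  refine squeeze_zero (fun _ => norm_nonneg _) (fun N => ?_)
    ((ht.mul_const h.im⁻¹).trans (by rw [zero_mul]))
  set w := (recipCauchy (dilation (1 / √(N : ℝ)) μ))^[N] z with hw
  have hwim : 0 < w.im := hz.trans_le (im_le_im_iterate_recipCauchy _ N hz)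
  have hle : h.im ≤ ‖w + h‖ := by
    have := (le_abs_self _).trans (Complex.abs_im_le_norm (w + h))
    rw [Complex.add_im] at this
    linarith
  rw [← div_eq_mul_inv, le_div_iff₀ him]
  calc ‖w - h‖ * h.im ≤ ‖w - h‖ * ‖w + h‖ := by gcongr
    _ = ‖w ^ 2 - h ^ 2‖ := by rw [← norm_mul]; congr 1; ring

/-! ### The monotone Poisson moments as polynomials in the parameter. -/

/-- The coefficients `∑ i₀ i₁ ⋯ i_{k-1}` of the monotone Poisson moments. -/
noncomputable def chainSum (n k : ℕ) : ℝ :=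
  if n = 0 then (if k = 0 then 1 else 0) else
    ∑ s ∈ (Finset.powersetCard k (Finset.Icc 1 n)).filter (fun s => 1 ∈ s), ∏ i ∈ s, (i : ℝ)

theorem chainSum_eq_zero {n k : ℕ} (h : n < k) : chainSum n k = 0 := by
  unfold chainSum
  split_ifs with h1 h2
  · omega
  · rfl
  · rw [Finset.powersetCard_eq_empty.2 (by simpa using h)]
    simp

/-- Split the sets according to whether they contain `n + 1`. The convention at `n = 0` makes the
recursion start there, where the new element is the compulsory `1`. -/
theorem chainSum_succ_succ (n k : ℕ) :
    chainSum (n + 1) (k + 1) = chainSum n (k + 1) + (n + 1) * chainSum n k := by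
  rcases Nat.eq_zero_or_pos n with rfl | hn
  · rcases Nat.eq_zero_or_pos k with rfl | hk
    · simp [chainSum, Finset.powersetCard_one, Finset.filter_singleton]
    · rw [chainSum_eq_zero (by omega)]
      simp [chainSum, hk.ne']
  · have hI : Finset.Icc 1 (n + 1) = insert (n + 1) (Finset.Icc 1 n) := by
      ext i
      simp only [Finset.mem_Icc, Finset.mem_insert]
      omega
    have hnot : n + 1 ∉ Finset.Icc 1 n := by simp
    have hmem {s : Finset ℕ} {j : ℕ} (hs : s ∈ (Finset.powersetCard j (Finset.Icc 1 n)).filter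
        (fun s => 1 ∈ s)) : n + 1 ∉ s := fun h =>
      hnot ((Finset.mem_powersetCard.1 (Finset.mem_filter.1 hs).1).1 h)
    simp only [chainSum, hn.ne', Nat.succ_ne_zero, if_false]
    rw [hI, Finset.powersetCard_succ_insert hnot, Finset.filter_union, Finset.sum_union]
    · congr 1
      rw [Finset.filter_image, Finset.mul_sum]
      have hf : (Finset.powersetCard k (Finset.Icc 1 n)).filter (fun s => 1 ∈ insert (n + 1) s)
          = (Finset.powersetCard k (Finset.Icc 1 n)).filter (fun s => 1 ∈ s) := by
        refine Finset.filter_congr fun s _ => ?_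
        simp only [Finset.mem_insert]
        constructor
        · rintro (h | h)
          · omega
          · exact h
        · exact Or.inr
      rw [hf, Finset.sum_image]
      · refine Finset.sum_congr rfl fun s hs => ?_
        rw [Finset.prod_insert (hmem hs)]
        push_cast
        rfl
      · intro s hs t ht hst
        rw [← Finset.erase_insert (hmem hs), ← Finset.erase_insert (hmem ht)]
        exact congrArg (Finset.erase · (n + 1)) hst
    · rw [Finset.disjoint_left]
      intro s hs hs'
      obtain ⟨t, -, rfl⟩ := Finset.mem_image.1 (Finset.mem_filter.1 hs').1
      exact hmem hs (Finset.mem_insert_self _ _)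

/-- The monotone Poisson moments as polynomials in the parameter, including order `0`. -/
noncomputable def poissonPoly (n : ℕ) (t : ℝ) : ℝ :=
  ∑ k ∈ Finset.range (n + 1), t ^ k / (k.factorial : ℝ) * chainSum n k

theorem poissonPoly_zero (t : ℝ) : poissonPoly 0 t = 1 := by
  simp [poissonPoly, chainSum]

theorem chainSum_zero_right {n : ℕ} (hn : n ≠ 0) : chainSum n 0 = 0 := by
  simp [chainSum, hn, Finset.filter_singleton]

theorem poissonPoly_eq {n : ℕ} (hn : 1 ≤ n) (t : ℝ) :
    poissonPoly n t = monotonePoissonMoment t n := by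
  have hn0 : n ≠ 0 := by omega
  rw [poissonPoly, Finset.sum_range_succ', chainSum_zero_right hn0, mul_zero, add_zero,
    monotonePoissonMoment, ← Finset.Ico_add_one_right_eq_Icc, Finset.sum_Ico_eq_sum_range]
  refine Finset.sum_congr (by simp) fun k _ => ?_
  rw [add_comm 1 k, chainSum, if_neg hn0, Finset.Ico_add_one_right_eq_Icc]

theorem poissonPoly_at_zero {n : ℕ} (hn : n ≠ 0) : poissonPoly n 0 = 0 := by
  rw [poissonPoly, Finset.sum_range_succ', chainSum_zero_right hn]
  simp

theorem hasDerivAt_sum_pow_div_factorial (a : ℕ → ℝ) (K : ℕ) (t : ℝ) :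
    HasDerivAt (fun t : ℝ => ∑ k ∈ Finset.range (K + 1), t ^ k / (k.factorial : ℝ) * a k)
      (∑ k ∈ Finset.range K, t ^ k / (k.factorial : ℝ) * a (k + 1)) t := by
  simp_rw [Finset.sum_range_succ' _ K]
  have h (k : ℕ) : HasDerivAt
      (fun t : ℝ => t ^ (k + 1) / ((k + 1).factorial : ℝ) * a (k + 1))
      (t ^ k / (k.factorial : ℝ) * a (k + 1)) t := by
    refine (((hasDerivAt_pow (k + 1) t).div_const _).mul_const _).congr_deriv ?_
    rw [Nat.factorial_succ]
    have : (k.factorial : ℝ) ≠ 0 := by positivity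
    push_cast
    field_simp
  simp only [pow_zero]
  exact (HasDerivAt.fun_sum fun k _ => h k).add_const _

theorem differentiable_poissonPoly (n : ℕ) : Differentiable ℝ (poissonPoly n) := fun t =>
  (hasDerivAt_sum_pow_div_factorial (chainSum n) n t).differentiableAt

theorem deriv_poissonPoly_zero (t : ℝ) : deriv (poissonPoly 0) t = 0 := by
  rw [funext poissonPoly_zero, deriv_const]

/-- This is the transport equation for the generating series, coefficient by coefficient. -/
theorem deriv_poissonPoly_succ (n : ℕ) (t : ℝ) :
    deriv (poissonPoly (n + 1)) t = deriv (poissonPoly n) t + (n + 1) * poissonPoly n t := by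
  have h1 := (hasDerivAt_sum_pow_div_factorial (chainSum (n + 1)) (n + 1) t).deriv
  have h2 := (hasDerivAt_sum_pow_div_factorial (chainSum n) n t).deriv
  change deriv (poissonPoly (n + 1)) t = _ at h1
  change deriv (poissonPoly n) t = _ at h2
  rw [h1, h2]
  have h3 : ∑ k ∈ Finset.range n, t ^ k / (k.factorial : ℝ) * chainSum n (k + 1)
      = ∑ k ∈ Finset.range (n + 1), t ^ k / (k.factorial : ℝ) * chainSum n (k + 1) := by
    rw [Finset.sum_range_succ, chainSum_eq_zero (Nat.lt_succ_self n), mul_zero, add_zero]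
  rw [h3, poissonPoly, Finset.mul_sum, ← Finset.sum_add_distrib]
  refine Finset.sum_congr rfl fun k _ => ?_
  rw [chainSum_succ_succ]
  ring

/-- Geometric growth comes from `∑_k (n choose k) (Tn)^k / k!` together with `(Tn)^k / k! ≤ e^{Tn}`.
It makes the series converge near infinity and the moment problem determinate. -/
theorem abs_poissonPoly_le {T t : ℝ} (ht : |t| ≤ T) (n : ℕ) :
    |poissonPoly n t| ≤ (2 * Real.exp T) ^ n := by
  have hT : 0 ≤ T := (abs_nonneg t).trans ht
  rcases Nat.eq_zero_or_pos n with rfl | hn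
  · simp [poissonPoly_zero]
  rw [poissonPoly_eq hn, monotonePoissonMoment]
  have hterm (k : ℕ) (hk : k ∈ Finset.Icc 1 n) : |t ^ k / (k.factorial : ℝ) *
      ∑ s ∈ (Finset.powersetCard k (Finset.Icc 1 n)).filter (fun s => 1 ∈ s), ∏ i ∈ s, (i : ℝ)| ≤
      (n.choose k : ℝ) * Real.exp T ^ n := by
    have h1 : ∑ s ∈ (Finset.powersetCard k (Finset.Icc 1 n)).filter (fun s => 1 ∈ s),
        ∏ i ∈ s, (i : ℝ) ≤ (n.choose k : ℝ) * (n : ℝ) ^ k := by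
      calc _ ≤ ∑ s ∈ Finset.powersetCard k (Finset.Icc 1 n), ∏ i ∈ s, (i : ℝ) :=
            Finset.sum_le_sum_of_subset_of_nonneg (Finset.filter_subset _ _) fun s _ _ =>
              Finset.prod_nonneg fun i _ => by positivity
        _ ≤ ∑ s ∈ Finset.powersetCard k (Finset.Icc 1 n), (n : ℝ) ^ k := by
            refine Finset.sum_le_sum fun s hs => ?_
            rw [Finset.mem_powersetCard] at hs
            rw [← hs.2, ← Finset.prod_const]
            refine Finset.prod_le_prod (fun i _ => by positivity) fun i hi => ?_
            exact_mod_cast (Finset.mem_Icc.1 (hs.1 hi)).2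
        _ = _ := by simp
    have h0 : 0 ≤ ∑ s ∈ (Finset.powersetCard k (Finset.Icc 1 n)).filter (fun s => 1 ∈ s),
        ∏ i ∈ s, (i : ℝ) :=
      Finset.sum_nonneg fun s _ => Finset.prod_nonneg fun i _ => by positivity
    rw [abs_mul, abs_of_nonneg h0, abs_div, abs_pow, Nat.abs_cast]
    calc _ ≤ T ^ k / (k.factorial : ℝ) * ((n.choose k : ℝ) * (n : ℝ) ^ k) := by gcongr
      _ = (n.choose k : ℝ) * ((T * n) ^ k / (k.factorial : ℝ)) := by rw [mul_pow]; ring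
      _ ≤ (n.choose k : ℝ) * Real.exp (T * n) := by
          gcongr
          exact Real.pow_div_factorial_le_exp _ (by positivity) _
      _ = _ := by rw [← Real.exp_nat_mul]; ring_nf
  refine (Finset.abs_sum_le_sum_abs _ _).trans ((Finset.sum_le_sum hterm).trans ?_)
  rw [← Finset.sum_mul, mul_pow]
  gcongr
  have h2 : ∑ k ∈ Finset.range (n + 1), (n.choose k : ℝ) = 2 ^ n := by
    exact_mod_cast Nat.sum_range_choose n
  rw [← h2]
  refine Finset.sum_le_sum_of_subset_of_nonneg (fun k hk => ?_) fun _ _ _ => by positivity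
  simp only [Finset.mem_Icc, Finset.mem_range] at hk ⊢
  omega

theorem abs_deriv_poissonPoly_le {T t : ℝ} (ht : |t| ≤ T) (n : ℕ) :
    |deriv (poissonPoly n) t| ≤ (n : ℝ) ^ 2 * (2 * Real.exp T) ^ n := by
  have hT : 0 ≤ T := (abs_nonneg t).trans ht
  have hC : 1 ≤ 2 * Real.exp T := by linarith [Real.one_le_exp hT]
  induction n with
  | zero => simp [deriv_poissonPoly_zero]
  | succ n ih =>
    rw [deriv_poissonPoly_succ]
    calc _ ≤ |deriv (poissonPoly n) t| + |(n + 1) * poissonPoly n t| := abs_add_le _ _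
      _ ≤ (n : ℝ) ^ 2 * (2 * Real.exp T) ^ n + (n + 1) * (2 * Real.exp T) ^ n := by
          rw [abs_mul, abs_of_nonneg (by positivity : (0 : ℝ) ≤ (n : ℝ) + 1)]
          gcongr
          exact abs_poissonPoly_le ht n
      _ = ((n : ℝ) ^ 2 + n + 1) * (2 * Real.exp T) ^ n := by ring
      _ ≤ ((n : ℝ) + 1) ^ 2 * (2 * Real.exp T) ^ (n + 1) := by
          gcongr
          · nlinarith [(Nat.cast_nonneg n : (0 : ℝ) ≤ n)]
          · omega
      _ = _ := by push_cast; rfl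

/-! ### The vector field `-z/(z-1)` and the transport equation. -/

theorem norm_monotonePoissonField_sub_le {a b : ℂ} (ha : 2 ≤ a.im) (hb : 2 ≤ b.im) :
    ‖-a / (a - 1) - -b / (b - 1)‖ ≤ ‖a - b‖ := by
  have hna : 1 ≤ ‖a - 1‖ := by
    have := im_le_norm_sub_ofReal a 1
    rw [Complex.ofReal_one] at this
    linarith
  have hnb : 1 ≤ ‖b - 1‖ := by
    have := im_le_norm_sub_ofReal b 1
    rw [Complex.ofReal_one] at this
    linarith
  have ha0 : a - 1 ≠ 0 := norm_pos_iff.1 (by linarith)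
  have hb0 : b - 1 ≠ 0 := norm_pos_iff.1 (by linarith)
  have : -a / (a - 1) - -b / (b - 1) = (a - b) / ((a - 1) * (b - 1)) := by
    field_simp
    ring
  rw [this, norm_div, norm_mul]
  exact div_le_self (norm_nonneg _) (one_le_mul_of_one_le_of_one_le hna hnb)

theorem norm_monotonePoissonField_le {a : ℂ} (ha : 1 ≤ a.im) : ‖-a / (a - 1)‖ ≤ 2 := by
  have hna : 1 ≤ ‖a - 1‖ := by
    have := im_le_norm_sub_ofReal a 1
    rw [Complex.ofReal_one] at this
    linarith
  rw [norm_div, norm_neg, div_le_iff₀ (by linarith)]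
  have := norm_add_le (a - 1) 1
  rw [sub_add_cancel, norm_one] at this
  linarith

/-- The Cauchy transform of the monotone Poisson distribution near infinity. -/
noncomputable def poissonSeries (t : ℝ) (z : ℂ) : ℂ :=
  ∑' n : ℕ, (poissonPoly n t : ℂ) * (z⁻¹) ^ (n + 1)

theorem poissonSeries_at_zero (z : ℂ) : poissonSeries 0 z = z⁻¹ := by
  rw [poissonSeries, tsum_eq_single 0]
  · simp [poissonPoly_zero]
  · intro n hn
    simp [poissonPoly_at_zero hn]

theorem norm_mul_inv_pow_le {C r : ℝ} (hC : 1 ≤ C) {z : ℂ} (hz : 2 * C ≤ ‖z‖) {a : ℂ} {n m : ℕ}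
    (hnm : n ≤ m) (hr : 0 ≤ r) (ha : ‖a‖ ≤ r * C ^ n) : ‖a * (z⁻¹) ^ m‖ ≤ r * (1 / 2) ^ n := by
  have hz1 : 1 ≤ ‖z‖ := by linarith
  rw [norm_mul, norm_pow, norm_inv]
  calc ‖a‖ * ‖z‖⁻¹ ^ m ≤ (r * C ^ n) * ((2 * C)⁻¹) ^ n := by
        refine mul_le_mul ha ?_ (by positivity) (by positivity)
        calc ‖z‖⁻¹ ^ m ≤ ‖z‖⁻¹ ^ n :=
              pow_le_pow_of_le_one (by positivity) (inv_le_one_of_one_le₀ hz1) hnm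
          _ ≤ _ := by gcongr
    _ = r * (1 / 2) ^ n := by
        rw [mul_assoc, ← mul_pow]
        congr 2
        field_simp

theorem summable_succ_mul_geometric : Summable fun n : ℕ => ((n : ℝ) + 1) * (1 / 2 : ℝ) ^ n := by
  have h1 := summable_pow_mul_geometric_of_norm_lt_one (R := ℝ) 1 (r := 1 / 2) (by norm_num)
  have h2 := summable_geometric_of_lt_one (r := (1 / 2 : ℝ)) (by norm_num) (by norm_num)
  refine (h1.add h2).congr fun n => ?_
  ring

theorem summable_sq_mul_geometric : Summable fun n : ℕ => ((n : ℝ) ^ 2) * (1 / 2 : ℝ) ^ n :=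
  summable_pow_mul_geometric_of_norm_lt_one (R := ℝ) 2 (r := 1 / 2) (by norm_num)

theorem norm_deriv_term_le {C t : ℝ} (hC : 1 ≤ C) {z : ℂ} (hz : 2 * C ≤ ‖z‖) (n : ℕ)
    (ht : |poissonPoly n t| ≤ C ^ n) :
    ‖((n : ℂ) + 1) * (poissonPoly n t : ℂ) * (z⁻¹) ^ (n + 2)‖ ≤ ((n : ℝ) + 1) * (1 / 2) ^ n := by
  refine norm_mul_inv_pow_le hC hz (by omega) (by positivity) ?_
  rw [norm_mul, Complex.norm_real, Real.norm_eq_abs]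
  have : ‖(n : ℂ) + 1‖ = (n : ℝ) + 1 := by exact_mod_cast Complex.norm_natCast (n + 1)
  rw [this]
  gcongr

theorem norm_deriv_coeff_term_le {C t : ℝ} (hC : 1 ≤ C) {z : ℂ} (hz : 2 * C ≤ ‖z‖) (n : ℕ)
    (ht : |deriv (poissonPoly n) t| ≤ (n : ℝ) ^ 2 * C ^ n) :
    ‖((deriv (poissonPoly n) t : ℝ) : ℂ) * (z⁻¹) ^ (n + 1)‖ ≤ (n : ℝ) ^ 2 * (1 / 2) ^ n := by
  refine norm_mul_inv_pow_le hC hz (by omega) (by positivity) ?_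
  rwa [Complex.norm_real, Real.norm_eq_abs]

/-- The transport equation `∂ₜ Q = V ∂_z Q` with `V = -z / (z - 1)` for the series. -/
theorem tsum_deriv_poissonPoly {T t : ℝ} (ht : |t| ≤ T) {z : ℂ}
    (hz : 2 * (2 * Real.exp T) ≤ ‖z‖) :
    ∑' n : ℕ, ((deriv (poissonPoly n) t : ℝ) : ℂ) * (z⁻¹) ^ (n + 1) =
      -(-z / (z - 1)) * ∑' n : ℕ, ((n : ℂ) + 1) * (poissonPoly n t : ℂ) * (z⁻¹) ^ (n + 2) := by
  have hC : 1 ≤ 2 * Real.exp T := by linarith [Real.one_le_exp ((abs_nonneg t).trans ht)]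
  have hz0 : z ≠ 0 := norm_pos_iff.1 (by linarith)
  have hz1 : z - 1 ≠ 0 := by
    intro h
    rw [sub_eq_zero.1 h, norm_one] at hz
    linarith
  have hs1 : Summable fun n : ℕ => ((deriv (poissonPoly n) t : ℝ) : ℂ) * (z⁻¹) ^ (n + 1) :=
    Summable.of_norm_bounded summable_sq_mul_geometric fun n =>
      norm_deriv_coeff_term_le hC hz n (abs_deriv_poissonPoly_le ht n)
  have hs2 : Summable fun n : ℕ => ((n : ℂ) + 1) * (poissonPoly n t : ℂ) * (z⁻¹) ^ (n + 2) :=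
    Summable.of_norm_bounded summable_succ_mul_geometric fun n =>
      norm_deriv_term_le hC hz n (abs_poissonPoly_le ht n)
  set S1 := ∑' n : ℕ, ((deriv (poissonPoly n) t : ℝ) : ℂ) * (z⁻¹) ^ (n + 1) with hS1
  set S2 := ∑' n : ℕ, ((n : ℂ) + 1) * (poissonPoly n t : ℂ) * (z⁻¹) ^ (n + 2) with hS2
  -- Summing the recursion for the derivatives gives this; solving, `S1 = z/(z-1) · S2`, where `S2`
  -- is `-∂_z Q`.
  have h1 : S1 = z⁻¹ * S1 + S2 := by
    conv_lhs => rw [hS1, hs1.tsum_eq_zero_add, deriv_poissonPoly_zero]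
    rw [Complex.ofReal_zero, zero_mul, zero_add, hS1, hS2, ← tsum_mul_left,
      ← (hs1.mul_left z⁻¹).tsum_add hs2]
    refine tsum_congr fun n => ?_
    rw [deriv_poissonPoly_succ]
    push_cast
    ring
  have h2 : z * S1 = S1 + z * S2 := by
    have := congrArg (z * ·) h1
    simp only [mul_add, mul_inv_cancel_left₀ hz0] at this
    exact this
  field_simp
  linear_combination h2

/-- A Lipschitz constant for the series in the far half-plane. -/
noncomputable def poissonLip : ℝ := ∑' n : ℕ, ((n : ℝ) + 1) * (1 / 2 : ℝ) ^ n

/-- Let `s ↦ Q(t-s, w+sv)` run along the segment from `w` to `w'` with constant velocity `v`. By the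
transport equation its derivative is `V(w+sv) - v` times a series bounded by `poissonLip`. Here
`|V(w) - v| ≤ η` by hypothesis, and the Lipschitz bound for `V` adds at most `s|v| ≤ h(η+2)`. -/
theorem norm_poissonSeries_sub_le {T t h η : ℝ} (ht0 : t < T) (hh0 : 0 < h) (hht : h ≤ t)
    {w w' : ℂ} (hw : 2 * (2 * Real.exp T) < w.im) (hw' : 2 * (2 * Real.exp T) < w'.im)
    (hη : ‖w' - w - h * (-w / (w - 1))‖ ≤ h * η) :
    ‖poissonSeries (t - h) w' - poissonSeries t w‖ ≤ h * (poissonLip * (η + h * (η + 2))) := by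
  have hT : 0 < T := by linarith
  have hC : 1 ≤ 2 * Real.exp T := by linarith [Real.one_le_exp hT.le]
  set v : ℂ := (w' - w) / h with hv
  have hh0' : (h : ℂ) ≠ 0 := by exact_mod_cast hh0.ne'
  -- Termwise differentiation needs an open connected set around `[0, h]`. The interval `(t-T, T)`
  -- contains it because `h ≤ t < T`, and keeps `|t - s| ≤ T`.
  set S : Set ℝ := {s | 2 * (2 * Real.exp T) < (w + s * v).im} ∩ Set.Ioo (t - T) T with hS
  have him (s : ℝ) : (w + s * v).im = w.im + s * v.im := by simp
  have hSo : IsOpen S := by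
    refine IsOpen.inter (isOpen_lt continuous_const ?_) isOpen_Ioo
    simp_rw [him]
    fun_prop
  have hSc : Convex ℝ S := by
    refine Convex.inter ?_ (convex_Ioo _ _)
    intro a ha b hb p q hp hq hpq
    simp only [Set.mem_ofPred_eq, him] at ha hb ⊢
    have hp' : p = 1 - q := by linarith
    subst hp'
    simp only [smul_eq_mul]
    have h1 := mul_le_mul_of_nonneg_left ha.le hp
    have h2 := mul_le_mul_of_nonneg_left hb.le hq
    rcases hp.eq_or_lt with hp0 | hp0
    · have : q = 1 := by linarith
      subst this
      simpa using hb
    · have h1 := mul_lt_mul_of_pos_left ha hp0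
      nlinarith
  have hwh : w + (h : ℂ) * v = w' := by
    rw [hv]
    field_simp
    ring
  have hSI : Set.Icc 0 h ⊆ S := by
    have h0S : (0 : ℝ) ∈ S := ⟨by simpa using hw, by constructor <;> linarith⟩
    have hhS : h ∈ S := ⟨by simpa only [Set.mem_ofPred_eq, hwh] using hw', by constructor <;> linarith⟩
    rw [← segment_eq_Icc hh0.le]
    exact hSc.segment_subset h0S hhS
  have habs {s : ℝ} (hs : s ∈ S) : |t - s| ≤ T := by
    have h2 := hs.2
    rw [abs_le]
    constructor <;> linarith [h2.1, h2.2]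
  have hnorm {s : ℝ} (hs : s ∈ S) : 2 * (2 * Real.exp T) ≤ ‖w + s * v‖ :=
    (show 2 * (2 * Real.exp T) < (w + s * v).im from hs.1).le.trans
      ((le_abs_self _).trans (Complex.abs_im_le_norm _))
  set g : ℕ → ℝ → ℂ := fun n s => (poissonPoly n (t - s) : ℂ) * ((w + s * v)⁻¹) ^ (n + 1) with hg
  set g' : ℕ → ℝ → ℂ := fun n s => -(((deriv (poissonPoly n) (t - s) : ℝ) : ℂ) *
    ((w + s * v)⁻¹) ^ (n + 1)) -
    v * (((n : ℂ) + 1) * (poissonPoly n (t - s) : ℂ) * ((w + s * v)⁻¹) ^ (n + 2)) with hg'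
  have hgd (n : ℕ) (s : ℝ) (hs : s ∈ S) : HasDerivAt (g n) (g' n s) s := by
    have hz0 : w + s * v ≠ 0 := norm_pos_iff.1 (by linarith [hnorm hs])
    have h1 : HasDerivAt (fun s : ℝ => (poissonPoly n (t - s) : ℂ))
        ((-(deriv (poissonPoly n) (t - s)) : ℝ) : ℂ) s := by
      have := ((differentiable_poissonPoly n (t - s)).hasDerivAt.comp s
        ((hasDerivAt_id s).const_sub t)).ofReal_comp
      simpa using this
    have h2 : HasDerivAt (fun s : ℝ => w + s * v) v s := by
      simpa using (((hasDerivAt_id s).ofReal_comp).mul_const v).const_add w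
    have h3 := (h2.fun_inv hz0).fun_pow (n + 1)
    refine (h1.mul h3).congr_deriv ?_
    simp only [hg', Nat.add_sub_cancel, div_eq_mul_inv, ← inv_pow]
    push_cast
    ring
  have hu : Summable fun n : ℕ => (n : ℝ) ^ 2 * (1 / 2 : ℝ) ^ n +
      ‖v‖ * (((n : ℝ) + 1) * (1 / 2 : ℝ) ^ n) :=
    summable_sq_mul_geometric.add (summable_succ_mul_geometric.mul_left _)
  have hb1 {s : ℝ} (hs : s ∈ S) (n : ℕ) := norm_deriv_coeff_term_le hC (hnorm hs) n
    (abs_deriv_poissonPoly_le (habs hs) n)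
  have hb2 {s : ℝ} (hs : s ∈ S) (n : ℕ) := norm_deriv_term_le hC (hnorm hs) n
    (abs_poissonPoly_le (habs hs) n)
  have hgb (n : ℕ) (s : ℝ) (hs : s ∈ S) : ‖g' n s‖ ≤ (n : ℝ) ^ 2 * (1 / 2 : ℝ) ^ n +
      ‖v‖ * (((n : ℝ) + 1) * (1 / 2 : ℝ) ^ n) := by
    refine (norm_sub_le _ _).trans ?_
    rw [norm_neg, norm_mul v]
    gcongr
    · exact hb1 hs n
    · exact hb2 hs n
  have h0S : (0 : ℝ) ∈ S := hSI ⟨le_rfl, hh0.le⟩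
  have hg0 : Summable fun n => g n 0 := by
    refine Summable.of_norm_bounded (g := fun n : ℕ => (1 : ℝ) * (1 / 2 : ℝ) ^ n)
      ((summable_geometric_of_lt_one (by norm_num) (by norm_num)).mul_left _) fun n => ?_
    refine norm_mul_inv_pow_le hC (hnorm h0S) (by omega) (by norm_num) ?_
    rw [Complex.norm_real, Real.norm_eq_abs, one_mul]
    exact abs_poissonPoly_le (habs h0S) n
  have hder (s : ℝ) (hs : s ∈ S) : HasDerivAt (fun s => ∑' n, g n s) (∑' n, g' n s) s :=
    hasDerivAt_tsum_of_isPreconnected hu hSo hSc.isPreconnected hgd hgb h0S hg0 hs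
  have hbound (s : ℝ) (hs : s ∈ Set.Icc 0 h) :
      ‖∑' n, g' n s‖ ≤ poissonLip * (η + h * (η + 2)) := by
    have hsS := hSI hs
    have hs1 : Summable fun n : ℕ => ((deriv (poissonPoly n) (t - s) : ℝ) : ℂ) *
        ((w + s * v)⁻¹) ^ (n + 1) :=
      Summable.of_norm_bounded summable_sq_mul_geometric (hb1 hsS)
    have hs2 : Summable fun n : ℕ => ((n : ℂ) + 1) * (poissonPoly n (t - s) : ℂ) *
        ((w + s * v)⁻¹) ^ (n + 2) :=
      Summable.of_norm_bounded summable_succ_mul_geometric (hb2 hsS)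
    have heq : ∑' n, g' n s = (-(w + s * v) / (w + s * v - 1) - v) *
        ∑' n : ℕ, ((n : ℂ) + 1) * (poissonPoly n (t - s) : ℂ) * ((w + s * v)⁻¹) ^ (n + 2) := by
      rw [hs1.neg.tsum_sub (hs2.mul_left v), tsum_neg, tsum_mul_left,
        tsum_deriv_poissonPoly (habs hsS) (hnorm hsS)]
      ring
    have hL : ‖∑' n : ℕ, ((n : ℂ) + 1) * (poissonPoly n (t - s) : ℂ) *
        ((w + s * v)⁻¹) ^ (n + 2)‖ ≤ poissonLip :=
      tsum_of_norm_bounded summable_succ_mul_geometric.hasSum (hb2 hsS)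
    have hη' : ‖-w / (w - 1) - v‖ ≤ η := by
      have h1 : w' - w - h * (-w / (w - 1)) = -(h * (-w / (w - 1) - v)) := by
        rw [hv]
        field_simp
        ring
      rw [h1, norm_neg, norm_mul, Complex.norm_real, Real.norm_of_nonneg hh0.le] at hη
      exact le_of_mul_le_mul_left hη hh0
    have hvn : ‖v‖ ≤ η + 2 := by
      have h1 := norm_sub_le (-w / (w - 1)) (-w / (w - 1) - v)
      rw [sub_sub_cancel] at h1
      have h2 := norm_monotonePoissonField_le (a := w) (by linarith)
      linarith
    have hV : ‖-(w + s * v) / (w + s * v - 1) - v‖ ≤ η + h * (η + 2) := by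
      have h1 := norm_monotonePoissonField_sub_le (a := w + s * v) (b := w)
        (by linarith [show 2 * (2 * Real.exp T) < (w + s * v).im from hsS.1]) (by linarith)
      rw [add_sub_cancel_left, norm_mul, Complex.norm_real, Real.norm_of_nonneg hs.1] at h1
      have h2 : s * ‖v‖ ≤ h * (η + 2) :=
        mul_le_mul hs.2 hvn (norm_nonneg _) hh0.le
      calc _ = ‖(-(w + s * v) / (w + s * v - 1) - -w / (w - 1)) + (-w / (w - 1) - v)‖ := by
            congr 1
            ring
        _ ≤ _ := norm_add_le _ _
        _ ≤ _ := by linarith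
    rw [heq, norm_mul, mul_comm]
    exact mul_le_mul hL hV (norm_nonneg _) ((norm_nonneg _).trans hL)
  have hmv := (convex_Icc (0 : ℝ) h).norm_image_sub_le_of_norm_hasDerivWithin_le
    (fun s hs => (hder s (hSI hs)).hasDerivWithinAt) hbound (Set.left_mem_Icc.2 hh0.le)
    (Set.right_mem_Icc.2 hh0.le)
  rw [sub_zero, Real.norm_of_nonneg hh0.le, mul_comm] at hmv
  have e1 : ∑' n, g n h = poissonSeries (t - h) w' := by
    simp only [hg, poissonSeries, hwh]
  have e0 : ∑' n, g n 0 = poissonSeries t w := by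
    simp [hg, poissonSeries]
  rwa [e1, e0] at hmv

/-! ### One step of the iteration and the law of small numbers. -/

/-- The distance of the rescaled moments of order at most four to those of the Poisson limit. -/
noncomputable def momentDefect (μ : ProbabilityMeasure ℝ) (N c : ℝ) : ℝ :=
  |N * moment μ 1 - c| + |N * moment μ 2 - c| + |N * moment μ 3 - N * moment μ 2| +
    (N * moment μ 4 - 2 * (N * moment μ 3) + N * moment μ 2)

theorem integral_sq_mul_sub_one_sq {μ : ProbabilityMeasure ℝ} (hμ : HasAllMoments μ) :
    ∫ x, x ^ 2 * (x - 1) ^ 2 ∂(μ : Measure ℝ) = moment μ 4 - 2 * moment μ 3 + moment μ 2 := by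
  simp only [moment]
  have h43 : Integrable (fun x : ℝ => x ^ 4 - 2 * x ^ 3) (μ : Measure ℝ) :=
    (hμ 4).sub ((hμ 3).const_mul 2)
  rw [← integral_const_mul, ← integral_sub (hμ 4) ((hμ 3).const_mul 2),
    ← integral_add h43 (hμ 2)]
  refine integral_congr_ae (Eventually.of_forall fun x => ?_)
  ring

theorem integrable_sq_mul_sub_one_sq {μ : ProbabilityMeasure ℝ} (hμ : HasAllMoments μ) :
    Integrable (fun x : ℝ => x ^ 2 * (x - 1) ^ 2) (μ : Measure ℝ) := by
  refine (((hμ 4).sub ((hμ 3).const_mul 2)).add (hμ 2)).congr (Eventually.of_forall fun x => ?_)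
  simp only [Pi.sub_apply, Pi.add_apply]
  ring

/-- Under the moment hypotheses the measures `N x² μ(dx)` concentrate at `x = 1`, so the kernel
`1/(w-x)` is expanded about `x = 1` to second order. The remainder carries `x²(x-1)²`, which is why
four moments suffice. -/
theorem norm_add_integral_sub_le {μ : ProbabilityMeasure ℝ} (hμ : HasAllMoments μ) {N c : ℝ}
    (hN : 0 ≤ N) {w : ℂ} (hw : 1 ≤ w.im) :
    ‖N * (moment μ 1 + ∫ x : ℝ, ((x ^ 2 : ℝ) : ℂ) * (w - x)⁻¹ ∂(μ : Measure ℝ)) -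
      c * (w / (w - 1))‖ ≤ momentDefect μ N c := by
  have hw' : 0 < w.im := by linarith
  have hna : 1 ≤ ‖w - 1‖ := by
    have := im_le_norm_sub_ofReal w 1
    rw [Complex.ofReal_one] at this
    linarith
  have ha0 : w - 1 ≠ 0 := norm_pos_iff.1 (by linarith)
  have hinv : ‖(w - 1)⁻¹‖ ≤ 1 := by
    rw [norm_inv]
    exact inv_le_one_of_one_le₀ hna
  set J := ∫ x : ℝ, ((x ^ 2 * (x - 1) ^ 2 : ℝ) : ℂ) * (w - x)⁻¹ ∂(μ : Measure ℝ) with hJ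
  have hJle : ‖J‖ ≤ moment μ 4 - 2 * moment μ 3 + moment μ 2 := by
    refine (norm_integral_mul_inv_sub_le (integrable_sq_mul_sub_one_sq hμ) hw').trans ?_
    rw [← integral_sq_mul_sub_one_sq hμ]
    have : ∫ x, |x ^ 2 * (x - 1) ^ 2| ∂(μ : Measure ℝ)
        = ∫ x, x ^ 2 * (x - 1) ^ 2 ∂(μ : Measure ℝ) :=
      integral_congr_ae (Eventually.of_forall fun x => abs_of_nonneg (by positivity))
    rw [this]
    exact div_le_self (integral_nonneg fun x => by positivity) hw
  have hm (k : ℕ) : (moment μ k : ℂ) = ∫ x : ℝ, ((x ^ k : ℝ) : ℂ) ∂(μ : Measure ℝ) :=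
    integral_ofReal.symm
  have hB : ∫ x : ℝ, ((x ^ 2 : ℝ) : ℂ) * (w - x)⁻¹ ∂(μ : Measure ℝ) =
      moment μ 2 * (w - 1)⁻¹ + (moment μ 3 - moment μ 2) * ((w - 1)⁻¹) ^ 2
        + J * ((w - 1)⁻¹) ^ 2 := by
    have i2 := integrable_complex_ofReal (hμ 2)
    have i3 := integrable_complex_ofReal (hμ 3)
    have iJ := integrable_mul_inv_sub (integrable_sq_mul_sub_one_sq hμ) hw'
    have i32 : Integrable (fun x : ℝ => ((x ^ 3 : ℝ) : ℂ) - ((x ^ 2 : ℝ) : ℂ)) (μ : Measure ℝ) :=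
      i3.sub i2
    have i4 : Integrable (fun x : ℝ => ((x ^ 2 : ℝ) : ℂ) * (w - 1)⁻¹ +
        (((x ^ 3 : ℝ) : ℂ) - ((x ^ 2 : ℝ) : ℂ)) * ((w - 1)⁻¹) ^ 2) (μ : Measure ℝ) :=
      (i2.mul_const _).add (i32.mul_const _)
    rw [hm 2, hm 3, hJ, ← integral_sub i3 i2, ← integral_mul_const, ← integral_mul_const,
      ← integral_mul_const, ← integral_add (i2.mul_const _) (i32.mul_const _),
      ← integral_add i4 (iJ.mul_const _)]
    refine integral_congr_ae (Eventually.of_forall fun x => ?_)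
    have := sub_ofReal_ne_zero hw'.ne' x
    push_cast
    field_simp
    ring
  have hid : N * (moment μ 1 + ∫ x : ℝ, ((x ^ 2 : ℝ) : ℂ) * (w - x)⁻¹ ∂(μ : Measure ℝ)) -
      c * (w / (w - 1)) = ((N * moment μ 1 - c : ℝ) : ℂ) +
        ((N * moment μ 2 - c : ℝ) : ℂ) * (w - 1)⁻¹ +
        ((N * moment μ 3 - N * moment μ 2 : ℝ) : ℂ) * ((w - 1)⁻¹) ^ 2 +
        (N : ℂ) * J * ((w - 1)⁻¹) ^ 2 := by
    rw [hB]
    have : w / (w - 1) = 1 + (w - 1)⁻¹ := by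
      field_simp
      ring
    rw [this]
    push_cast
    ring
  rw [hid, momentDefect]
  have hinv2 : ‖((w - 1)⁻¹) ^ 2‖ ≤ 1 := by
    rw [norm_pow]
    exact pow_le_one₀ (norm_nonneg _) hinv
  refine (norm_add_le _ _).trans (add_le_add ((norm_add_le _ _).trans (add_le_add
    ((norm_add_le _ _).trans (add_le_add ?_ ?_)) ?_)) ?_)
  · rw [Complex.norm_real, Real.norm_eq_abs]
  · rw [norm_mul, Complex.norm_real, Real.norm_eq_abs]
    exact mul_le_of_le_one_right (abs_nonneg _) hinv
  · rw [norm_mul, Complex.norm_real, Real.norm_eq_abs]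
    exact mul_le_of_le_one_right (abs_nonneg _) hinv2
  · rw [norm_mul, norm_mul, Complex.norm_real, Real.norm_of_nonneg hN]
    calc _ ≤ N * ‖J‖ := mul_le_of_le_one_right (by positivity) hinv2
      _ ≤ N * (moment μ 4 - 2 * moment μ 3 + moment μ 2) := by gcongr
      _ = _ := by ring

/-- With `H = w²/(w+a)` one has `H - w = -a + a²/(w+a)`, where `N a` is within the moment defect of
`-c V`. The size condition on `N` gives `|a| ≤ 1/2`, hence `|w+a| ≥ 1/2`. -/
theorem norm_recipCauchy_sub_field_le {μ : ProbabilityMeasure ℝ} (hμ : HasAllMoments μ) {N c : ℝ}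
    (hc : 0 < c) (hNpos : 0 < N) (hN : 2 * (2 * c + momentDefect μ N c) ≤ N) {w : ℂ} (hw : 1 ≤ w.im) :
    ‖recipCauchy μ w - w - (c / N : ℝ) * (-w / (w - 1))‖ ≤
      (c / N) * ((momentDefect μ N c + 2 * (2 * c + momentDefect μ N c) ^ 2 / N) / c) := by
  have hw' : 0 < w.im := by linarith
  have hw1 : 1 ≤ ‖w‖ := hw.trans ((le_abs_self _).trans (Complex.abs_im_le_norm w))
  set E := momentDefect μ N c with hE
  have hV := norm_monotonePoissonField_le hw
  set V := -w / (w - 1) with hVdef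
  set a : ℂ := moment μ 1 + ∫ x : ℝ, ((x ^ 2 : ℝ) : ℂ) * (w - x)⁻¹ ∂(μ : Measure ℝ) with ha
  have hVn : c * (w / (w - 1)) = -(c * V) := by
    rw [hVdef]
    ring
  have hEb : ‖N * a + c * V‖ ≤ E := by
    have := norm_add_integral_sub_le hμ (c := c) hNpos.le hw
    rwa [← ha, hVn, sub_neg_eq_add] at this
  have hNc : (N : ℂ) ≠ 0 := by exact_mod_cast hNpos.ne'
  have hEnn : 0 ≤ E := (norm_nonneg _).trans hEb
  have haN : ‖a‖ ≤ (2 * c + E) / N := by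
    rw [le_div_iff₀ hNpos]
    calc ‖a‖ * N = ‖N * a‖ := by rw [norm_mul, Complex.norm_real, Real.norm_of_nonneg hNpos.le,
                                    mul_comm]
      _ = ‖(N * a + c * V) - c * V‖ := by congr 1; ring
      _ ≤ E + c * 2 := by
          refine (norm_sub_le _ _).trans (add_le_add hEb ?_)
          rw [norm_mul, Complex.norm_real, Real.norm_of_nonneg hc.le]
          gcongr
      _ = _ := by ring
  have ha2 : ‖a‖ ≤ 1 / 2 := by
    refine haN.trans ?_
    rw [div_le_iff₀ hNpos]
    linarith
  have hwa : 1 / 2 ≤ ‖w + a‖ := by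
    have := norm_sub_norm_le w (-a)
    rw [norm_neg, sub_neg_eq_add] at this
    linarith
  have hwa0 : w + a ≠ 0 := norm_pos_iff.1 (by linarith)
  have hH : recipCauchy μ w = w ^ 2 / (w + a) := by
    rw [eq_div_iff hwa0]
    exact recipCauchy_mul_add hμ hw'
  have hid : recipCauchy μ w - w - (c / N : ℝ) * V
      = -((N * a + c * V) / N) + a ^ 2 / (w + a) := by
    rw [hH]
    push_cast
    field_simp
    ring
  rw [hid]
  refine (norm_add_le _ _).trans ?_
  have hfin : (c / N) * ((E + 2 * (2 * c + E) ^ 2 / N) / c)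
      = E / N + ((2 * c + E) / N) ^ 2 / (1 / 2) := by
    field_simp
  rw [hfin, norm_neg, norm_div, norm_div, norm_pow, Complex.norm_real,
    Real.norm_of_nonneg hNpos.le]
  gcongr

/-- Telescope `Q(c - kh, H^k(z))` with `h = c/N`: at `k = 0` it is `Q(c,z)`, and at `k = N` it is
the reciprocal of the last iterate. The `N` increments of size `O(h)` times the step error total `c`
times that error. -/
theorem norm_inv_iterate_sub_poissonSeries_le {μ : ProbabilityMeasure ℝ} {c η : ℝ} (hc : 0 < c)
    {N : ℕ} (hN : 0 < N) {z : ℂ} (hz : 2 * (2 * Real.exp (c + 1)) < z.im)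
    (hstep : ∀ w : ℂ, 1 ≤ w.im →
      ‖recipCauchy μ w - w - (c / N : ℝ) * (-w / (w - 1))‖ ≤ (c / N) * η) :
    ‖((recipCauchy μ)^[N] z)⁻¹ - poissonSeries c z‖ ≤
      c * (poissonLip * (η + (c / N) * (η + 2))) := by
  have hN' : (0 : ℝ) < N := by exact_mod_cast hN
  have hexp : 1 ≤ Real.exp (c + 1) := Real.one_le_exp (by linarith)
  have hz0 : 0 < z.im := by linarith
  set h := c / N with hh
  have hh0 : 0 < h := by positivity
  have key (k : ℕ) (hk : k ≤ N) :
      ‖poissonSeries (c - k * h) ((recipCauchy μ)^[k] z) - poissonSeries c z‖ ≤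
        k * (h * (poissonLip * (η + h * (η + 2)))) := by
    induction k with
    | zero => simp
    | succ k ih =>
      have him := im_le_im_iterate_recipCauchy μ k hz0
      have him' := im_le_im_iterate_recipCauchy μ (k + 1) hz0
      have hkN : ((k + 1 : ℕ) : ℝ) ≤ N := by exact_mod_cast hk
      have hle : h ≤ c - k * h := by
        have : ((k + 1 : ℕ) : ℝ) * h ≤ N * h := by gcongr
        rw [hh, mul_div_cancel₀ c hN'.ne', ← hh] at this
        push_cast at this
        linarith
      have hkh : 0 ≤ (k : ℝ) * h := by positivity
      -- The choice `T = c + 1` keeps all times `c - kh` strictly below `T`.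
      have h1 := norm_poissonSeries_sub_le (T := c + 1) (t := c - k * h) (h := h) (η := η)
        (w := (recipCauchy μ)^[k] z) (w' := (recipCauchy μ)^[k + 1] z) (by linarith) hh0 hle
        (by linarith) (by linarith)
        (by
          rw [Function.iterate_succ_apply']
          exact hstep _ (by linarith))
      have h2 := norm_add_le
        (poissonSeries (c - k * h - h) ((recipCauchy μ)^[k + 1] z) -
          poissonSeries (c - k * h) ((recipCauchy μ)^[k] z))
        (poissonSeries (c - k * h) ((recipCauchy μ)^[k] z) - poissonSeries c z)
      rw [sub_add_sub_cancel] at h2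
      have h3 : c - ((k + 1 : ℕ) : ℝ) * h = c - k * h - h := by
        push_cast
        ring
      rw [h3]
      refine h2.trans ((add_le_add h1 (ih (by omega))).trans_eq ?_)
      push_cast
      ring
  have hfin := key N le_rfl
  have hNh : (N : ℝ) * h = c := by rw [hh]; field_simp
  rwa [hNh, sub_self, poissonSeries_at_zero, ← mul_assoc, hNh] at hfin

theorem tendsto_cauchyTransform_monotoneConvPow_poissonSeries {μ : ℕ → ProbabilityMeasure ℝ}
    {c : ℝ} (hc : 0 < c) (hμ : ∀ N : ℕ, 1 ≤ N → HasAllMoments (μ N))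
    (hm : ∀ k : ℕ, 1 ≤ k →
      Tendsto (fun N : ℕ => (N : ℝ) * moment (μ N) k) atTop (𝓝 c)) {z : ℂ}
    (hz : 2 * (2 * Real.exp (c + 1)) < z.im) :
    Tendsto (fun N : ℕ => cauchyTransform (monotoneConvPow (μ N) N) z) atTop
      (𝓝 (poissonSeries c z)) := by
  have hz0 : 0 < z.im := by linarith [Real.exp_pos (c + 1)]
  have hE : Tendsto (fun N : ℕ => momentDefect (μ N) N c) atTop (𝓝 0) := by
    have h1 := ((hm 1 le_rfl).sub_const c).abs
    have h2 := ((hm 2 (by norm_num)).sub_const c).abs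
    have h3 := ((hm 3 (by norm_num)).sub (hm 2 (by norm_num))).abs
    have h4 := ((hm 4 (by norm_num)).sub ((hm 3 (by norm_num)).const_mul 2)).add
      (hm 2 (by norm_num))
    have := ((h1.add h2).add h3).add h4
    refine this.trans (le_of_eq ?_)
    congr 1
    simp
    ring
  have hinv : Tendsto (fun N : ℕ => (N : ℝ)⁻¹) atTop (𝓝 0) := tendsto_inv_atTop_nhds_zero_nat
  set η : ℕ → ℝ := fun N => (momentDefect (μ N) N c +
    2 * (2 * c + momentDefect (μ N) N c) ^ 2 / N) / c with hη
  have hη0 : Tendsto η atTop (𝓝 0) := by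
    have := (hE.add ((((hE.const_add (2 * c)).pow 2).const_mul 2).mul hinv)).div_const c
    simpa [hη, div_eq_mul_inv] using this
  rw [tendsto_iff_norm_sub_tendsto_zero]
  have hlim : Tendsto (fun N : ℕ => c * (poissonLip * (η N + (c / N) * (η N + 2)))) atTop
      (𝓝 0) := by
    have := ((hη0.add ((hinv.const_mul c).mul (hη0.add_const 2))).const_mul poissonLip).const_mul c
    simpa [div_eq_mul_inv] using this
  refine squeeze_zero' (Eventually.of_forall fun _ => norm_nonneg _) ?_ hlim
  have hev : ∀ᶠ N : ℕ in atTop, 2 * (2 * c + momentDefect (μ N) N c) ≤ N := by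
    have h1 : ∀ᶠ N : ℕ in atTop, momentDefect (μ N) N c ≤ 1 := hE.eventually_le_const one_pos
    have h2 : ∀ᶠ N : ℕ in atTop, 2 * (2 * c + 1) ≤ (N : ℝ) :=
      tendsto_natCast_atTop_atTop.eventually_ge_atTop _
    filter_upwards [h1, h2] with N h1 h2
    linarith
  filter_upwards [hev, eventually_gt_atTop 0] with N hN hN0
  rw [cauchyTransform_monotoneConvPow _ _ hz0]
  exact norm_inv_iterate_sub_poissonSeries_le hc hN0 hz fun w hw =>
    norm_recipCauchy_sub_field_le (hμ N hN0) hc (by exact_mod_cast hN0) hN hw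

/-! ### Moments and the expansion of the Cauchy transform at infinity. -/

/-- The Laurent series at infinity `∑ mₙ z⁻ⁿ⁻¹`. -/
noncomputable def momentSeries (m : ℕ → ℝ) (z : ℂ) : ℂ :=
  ∑' n : ℕ, (m n : ℂ) * (z⁻¹) ^ (n + 1)

/-- The Cauchy transform of the signed measure `f · μ`. -/
noncomputable def weightedCauchy (μ : ProbabilityMeasure ℝ) (f : ℝ → ℝ) (z : ℂ) : ℂ :=
  ∫ x : ℝ, (f x : ℂ) * (z - x)⁻¹ ∂(μ : Measure ℝ)

theorem norm_momentSeries_term_le {m : ℕ → ℝ} {A C : ℝ} (hC : 1 ≤ C) (hm : ∀ n, |m n| ≤ A * C ^ n)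
    {z : ℂ} (hz : 2 * C ≤ ‖z‖) (n : ℕ) :
    ‖(m n : ℂ) * (z⁻¹) ^ (n + 1)‖ ≤ A * (1 / 2) ^ n * ‖z‖⁻¹ := by
  have hA : 0 ≤ A := by simpa using (abs_nonneg _).trans (hm 0)
  rw [pow_succ, ← mul_assoc, norm_mul _ z⁻¹, norm_inv]
  gcongr
  refine norm_mul_inv_pow_le hC hz le_rfl hA ?_
  rw [Complex.norm_real, Real.norm_eq_abs]
  exact hm n

theorem hasSum_bound (A : ℝ) (z : ℂ) :
    HasSum (fun n : ℕ => A * (1 / 2 : ℝ) ^ n * ‖z‖⁻¹) (A * 2 * ‖z‖⁻¹) :=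
  (hasSum_geometric_two.mul_left A).mul_right _

theorem summable_momentSeries {m : ℕ → ℝ} {A C : ℝ} (hC : 1 ≤ C) (hm : ∀ n, |m n| ≤ A * C ^ n)
    {z : ℂ} (hz : 2 * C ≤ ‖z‖) : Summable fun n : ℕ => (m n : ℂ) * (z⁻¹) ^ (n + 1) :=
  Summable.of_norm_bounded (hasSum_bound A z).summable (norm_momentSeries_term_le hC hm hz)

theorem norm_momentSeries_le {m : ℕ → ℝ} {A C : ℝ} (hC : 1 ≤ C) (hm : ∀ n, |m n| ≤ A * C ^ n)
    {z : ℂ} (hz : 2 * C ≤ ‖z‖) : ‖momentSeries m z‖ ≤ A * 2 * ‖z‖⁻¹ :=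
  tsum_of_norm_bounded (hasSum_bound A z) (norm_momentSeries_term_le hC hm hz)

theorem mul_momentSeries {m : ℕ → ℝ} {A C : ℝ} (hC : 1 ≤ C) (hm : ∀ n, |m n| ≤ A * C ^ n)
    {z : ℂ} (hz : 2 * C ≤ ‖z‖) :
    z * momentSeries m z = m 0 + momentSeries (fun n => m (n + 1)) z := by
  have hz0 : z ≠ 0 := norm_pos_iff.1 (by linarith)
  rw [momentSeries, (summable_momentSeries hC hm hz).tsum_eq_zero_add, mul_add, momentSeries,
    ← tsum_mul_left]
  congr 1
  · rw [zero_add, pow_one, mul_comm, mul_assoc, inv_mul_cancel₀ hz0, mul_one]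
  · refine tsum_congr fun n => ?_
    rw [pow_succ _ (n + 1)]
    field_simp

theorem abs_shift_le {m : ℕ → ℝ} {A C : ℝ} (hm : ∀ n, |m n| ≤ A * C ^ n) (j n : ℕ) :
    |m (n + j)| ≤ A * C ^ j * C ^ n := by
  rw [mul_assoc, ← pow_add, add_comm j]
  exact hm _

theorem tendsto_momentSeries_I {m : ℕ → ℝ} {A C : ℝ} (hC : 1 ≤ C)
    (hm : ∀ n, |m n| ≤ A * C ^ n) :
    Tendsto (fun y : ℝ => momentSeries m (y * Complex.I)) atTop (𝓝 0) := by
  refine squeeze_zero_norm' (a := fun y : ℝ => A * 2 * y⁻¹) ?_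
    (by simpa using tendsto_inv_atTop_zero.const_mul (A * 2))
  filter_upwards [eventually_ge_atTop (2 * C)] with y hy
  have hn : ‖(y * Complex.I : ℂ)‖ = y := by simp [abs_of_nonneg (by linarith : 0 ≤ y)]
  simpa only [hn] using norm_momentSeries_le hC hm (z := y * Complex.I) (by rw [hn]; exact hy)

theorem mul_weightedCauchy {μ : ProbabilityMeasure ℝ} {f : ℝ → ℝ}
    (hf : Integrable f (μ : Measure ℝ)) {z : ℂ} (hz : 0 < z.im) :
    z * weightedCauchy μ f z = (∫ x, f x ∂(μ : Measure ℝ) : ℝ) +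
      weightedCauchy μ (fun x => x * f x) z := by
  have h1 : ((∫ x, f x ∂(μ : Measure ℝ) : ℝ) : ℂ) = ∫ x, (f x : ℂ) ∂(μ : Measure ℝ) :=
    integral_ofReal.symm
  have hi := (integrable_mul_inv_sub hf hz).const_mul z
  rw [← sub_eq_iff_eq_add', h1, weightedCauchy, weightedCauchy, ← integral_const_mul,
    ← integral_sub hi (integrable_complex_ofReal hf)]
  refine integral_congr_ae (Eventually.of_forall fun x => ?_)
  have := sub_ofReal_ne_zero hz.ne' x
  push_cast
  field_simp
  ring

/-- Since `|x / (iy - x)| ≤ 1`, the integrand is dominated by `|f|`, so integrability of `x f` is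
not needed. -/
theorem tendsto_weightedCauchy_id_mul {μ : ProbabilityMeasure ℝ} {f : ℝ → ℝ}
    (hf : Integrable f (μ : Measure ℝ)) :
    Tendsto (fun y : ℝ => weightedCauchy μ (fun x => x * f x) (y * Complex.I)) atTop (𝓝 0) := by
  have h0 : (0 : ℂ) = ∫ _x : ℝ, (0 : ℂ) ∂(μ : Measure ℝ) := by simp
  rw [h0]
  have hle (y x : ℝ) : |x| ≤ ‖(y * Complex.I : ℂ) - x‖ := by
    simpa using Complex.abs_re_le_norm ((y * Complex.I : ℂ) - x)
  refine tendsto_integral_filter_of_dominated_convergence (fun x => |f x|) ?_ ?_ hf.abs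
    (Eventually.of_forall fun x => ?_)
  · filter_upwards [eventually_gt_atTop 0] with y hy
    have hc := (continuous_inv_sub_ofReal (z := y * Complex.I)
      (by simpa using hy.ne')).aestronglyMeasurable (μ := (μ : Measure ℝ))
    have hx : AEStronglyMeasurable (fun x : ℝ => ((x * f x : ℝ) : ℂ)) (μ : Measure ℝ) :=
      Complex.continuous_ofReal.comp_aestronglyMeasurable
        (continuous_id.aestronglyMeasurable.mul hf.aestronglyMeasurable)
    exact hx.mul hc
  · filter_upwards [eventually_gt_atTop 0] with y hy
    refine Eventually.of_forall fun x => ?_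
    have hpos : 0 < ‖(y * Complex.I : ℂ) - x‖ :=
      norm_pos_iff.2 (sub_ofReal_ne_zero (by simpa using hy.ne') x)
    rw [norm_mul, Complex.norm_real, Real.norm_eq_abs, abs_mul, norm_inv, ← div_eq_mul_inv,
      div_le_iff₀ hpos, mul_comm]
    exact mul_le_mul_of_nonneg_left (hle y x) (abs_nonneg _)
  · refine squeeze_zero_norm' (a := fun y : ℝ => |x * f x| * y⁻¹) ?_
      (by simpa using tendsto_inv_atTop_zero.const_mul |x * f x|)
    filter_upwards [eventually_gt_atTop 0] with y hy
    rw [norm_mul, Complex.norm_real, Real.norm_eq_abs]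
    gcongr
    simpa using norm_inv_sub_ofReal_le (z := y * Complex.I) (by simpa using hy) x

/-- Multiply both sides by `z = iy` and let `y → ∞`: the leading coefficients agree, and what
remains is the same identity for `x f` and the shifted sequence. -/
theorem integral_eq_of_weightedCauchy_eq {μ : ProbabilityMeasure ℝ} {f : ℝ → ℝ}
    (hf : Integrable f (μ : Measure ℝ)) {m : ℕ → ℝ} {A C : ℝ} (hC : 1 ≤ C)
    (hm : ∀ n, |m n| ≤ A * C ^ n)
    (h : ∀ y : ℝ, 2 * C < y → weightedCauchy μ f (y * Complex.I) = momentSeries m (y * Complex.I)) :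
    ∫ x, f x ∂(μ : Measure ℝ) = m 0 ∧ ∀ y : ℝ, 2 * C < y →
      weightedCauchy μ (fun x => x * f x) (y * Complex.I) =
        momentSeries (fun n => m (n + 1)) (y * Complex.I) := by
  have key (y : ℝ) (hy : 2 * C < y) : ((∫ x, f x ∂(μ : Measure ℝ) : ℝ) : ℂ) +
      weightedCauchy μ (fun x => x * f x) (y * Complex.I) =
        m 0 + momentSeries (fun n => m (n + 1)) (y * Complex.I) := by
    have hy0 : 0 < y := by linarith
    rw [← mul_weightedCauchy hf (by simpa using hy0), h y hy, mul_momentSeries hC hm]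
    simp [abs_of_pos hy0, hy.le]
  have h0 : ((∫ x, f x ∂(μ : Measure ℝ) : ℝ) : ℂ) = m 0 := by
    have h1 := (tendsto_weightedCauchy_id_mul hf).const_add
      ((∫ x, f x ∂(μ : Measure ℝ) : ℝ) : ℂ)
    have h2 := (tendsto_momentSeries_I hC (abs_shift_le hm 1)).const_add (m 0 : ℂ)
    rw [add_zero] at h1 h2
    refine tendsto_nhds_unique (h1.congr' ?_) h2
    filter_upwards [eventually_gt_atTop (2 * C)] with y hy using key y hy
  refine ⟨by exact_mod_cast h0, fun y hy => ?_⟩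
  have := key y hy
  rw [h0] at this
  exact add_left_cancel this

/-- The integral of `y²/(x²+y²) · x² f` is the real part of `(iy)²` times the weighted transform of
`x f`, which the series bounds uniformly in `y`. As `f ≥ 0`, Fatou gives integrability in the limit.
-/
theorem integrable_sq_mul_of_weightedCauchy_eq {μ : ProbabilityMeasure ℝ} {f : ℝ → ℝ}
    (hf : Integrable f (μ : Measure ℝ)) (hf0 : ∀ x, 0 ≤ f x) {m : ℕ → ℝ} {A C : ℝ} (hC : 1 ≤ C)
    (hm : ∀ n, |m n| ≤ A * C ^ n)
    (h : ∀ y : ℝ, 2 * C < y → weightedCauchy μ f (y * Complex.I) = momentSeries m (y * Complex.I)) :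
    Integrable (fun x => x ^ 2 * f x) (μ : Measure ℝ) := by
  have hxf := (integral_eq_of_weightedCauchy_eq hf hC hm h).2
  set g : ℝ → ℝ → ℝ := fun y x => y ^ 2 * (x ^ 2 + y ^ 2)⁻¹ * (x ^ 2 * f x) with hg
  have hg0 (y x : ℝ) : 0 ≤ g y x := by
    have := hf0 x
    positivity
  have hgi (y : ℝ) (hy : 0 < y) : Integrable (g y) (μ : Measure ℝ) := by
    have h1 : Continuous fun x : ℝ => y ^ 2 * (x ^ 2 + y ^ 2)⁻¹ * x ^ 2 := by
      refine (continuous_const.mul (Continuous.inv₀ (by fun_prop) fun x => ?_)).mul (by fun_prop)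
      positivity
    refine (hf.bdd_mul (c := y ^ 2) h1.aestronglyMeasurable (Eventually.of_forall fun x => ?_)).congr
      (Eventually.of_forall fun x => ?_)
    · have hp : 0 < x ^ 2 + y ^ 2 := by positivity
      rw [Real.norm_of_nonneg (by positivity), mul_assoc]
      refine mul_le_of_le_one_right (sq_nonneg y) ?_
      rw [inv_mul_le_iff₀ hp]
      nlinarith [sq_nonneg y]
    · simp only [hg]
      ring
  have hbound (y : ℝ) (hy : 2 * C < y) : ∫ x, g y x ∂(μ : Measure ℝ) ≤ A * C ^ 2 * 2 := by
    have hy0 : 0 < y := by linarith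
    have him : 0 < (y * Complex.I : ℂ).im := by simpa using hy0
    have hny : ‖(y * Complex.I : ℂ)‖ = y := by simp [abs_of_pos hy0]
    have hint : Integrable (fun x : ℝ => ((x * f x : ℝ) : ℂ) * ((y * Complex.I : ℂ) - x)⁻¹)
        (μ : Measure ℝ) := by
      have h1 := ((integrable_mul_inv_sub hf him).const_mul (y * Complex.I)).sub
        (integrable_complex_ofReal hf)
      refine h1.congr (Eventually.of_forall fun x => ?_)
      have := sub_ofReal_ne_zero him.ne' x
      simp only [Pi.sub_apply]
      push_cast
      field_simp
      ring
    have hre : ∫ x, g y x ∂(μ : Measure ℝ)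
        = ((y * Complex.I) * ((y * Complex.I) *
          weightedCauchy μ (fun x => x * f x) (y * Complex.I))).re := by
      have h1 := integral_re ((hint.const_mul (y * Complex.I)).const_mul (y * Complex.I))
      simp only [RCLike.re_to_complex] at h1
      rw [integral_const_mul, integral_const_mul] at h1
      rw [weightedCauchy, ← h1]
      refine integral_congr_ae (Eventually.of_forall fun x => ?_)
      have hp : x ^ 2 + y ^ 2 ≠ 0 := by positivity
      have hns : Complex.normSq ((y * Complex.I : ℂ) - x) = x ^ 2 + y ^ 2 := by
        rw [Complex.normSq_apply]
        simp
        ring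
      simp only [hg, Complex.mul_re, Complex.mul_im, Complex.inv_re, Complex.inv_im, hns]
      simp
      field_simp
    rw [hre, hxf y hy, mul_momentSeries hC (abs_shift_le hm 1) (by rw [hny]; exact hy.le), mul_add,
      Complex.add_re]
    -- The only term growing with `y` is purely imaginary, so the real part does not see it.
    have hz : ((y * Complex.I : ℂ) * (m (0 + 1) : ℂ)).re = 0 := by simp
    rw [hz, zero_add]
    refine (Complex.re_le_norm _).trans ?_
    rw [norm_mul, hny]
    have h2 := norm_momentSeries_le hC (m := fun n => m (n + 1 + 1))
      (fun n => abs_shift_le hm 2 n) (z := y * Complex.I) (by rw [hny]; exact hy.le)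
    rw [hny] at h2
    calc _ ≤ y * (A * C ^ 2 * 2 * y⁻¹) := by gcongr
      _ = _ := by field_simp
  set Y : ℕ → ℝ := fun n => n + (2 * C + 1) with hY
  have hYC (n : ℕ) : 2 * C < Y n := by
    simp only [hY]
    have : (0 : ℝ) ≤ n := Nat.cast_nonneg n
    linarith
  have hYpos (n : ℕ) : 0 < Y n := by linarith [hYC n]
  have hYt : Tendsto Y atTop atTop :=
    tendsto_atTop_add_const_right _ _ tendsto_natCast_atTop_atTop
  refine integrable_of_tendsto (G := fun n => g (Y n)) (Eventually.of_forall fun x => ?_)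
    (fun n => (hgi _ (hYpos n)).aestronglyMeasurable) ?_
  · have h1 : Tendsto (fun n => x ^ 2 * ((Y n)⁻¹) ^ 2 + 1) atTop (𝓝 1) := by
      simpa using (((tendsto_inv_atTop_zero.comp hYt).pow 2).const_mul (x ^ 2)).add_const 1
    have h2 := (h1.inv₀ one_ne_zero).mul_const (x ^ 2 * f x)
    rw [inv_one, one_mul] at h2
    refine h2.congr fun n => ?_
    have := hYpos n
    simp only [hg]
    congr 1
    field_simp
  · refine ne_top_of_le_ne_top (ENNReal.ofReal_ne_top (r := A * C ^ 2 * 2)) ?_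
    refine liminf_le_of_le (h := ?_) (by isBoundedDefault)
    intro b hb
    obtain ⟨n, hn⟩ := hb.exists
    refine hn.trans ?_
    rw [← ofReal_integral_norm_eq_lintegral_enorm (hgi _ (hYpos n))]
    refine ENNReal.ofReal_le_ofReal ?_
    simp only [Real.norm_of_nonneg (hg0 _ _)]
    exact hbound _ (hYC n)

/-- Hamburger–Nevanlinna: the expansion of the Cauchy transform at `i∞` determines the moments. -/
theorem hasAllMoments_of_cauchyTransform_eq {μ : ProbabilityMeasure ℝ} {m : ℕ → ℝ} {C : ℝ}
    (hC : 1 ≤ C) (hm : ∀ n, |m n| ≤ C ^ n)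
    (h : ∀ y : ℝ, 2 * C < y →
      cauchyTransform μ (y * Complex.I) = momentSeries m (y * Complex.I)) :
    HasAllMoments μ ∧ ∀ n, moment μ n = m n := by
  have hm' (j n : ℕ) : |m (n + j)| ≤ 1 * C ^ j * C ^ n :=
    abs_shift_le (fun n => by simpa using hm n) j n
  have step (n : ℕ) (h1 : Integrable (fun x : ℝ => x ^ (2 * n)) (μ : Measure ℝ))
      (h2 : ∀ y : ℝ, 2 * C < y → weightedCauchy μ (fun x => x ^ (2 * n)) (y * Complex.I) =
        momentSeries (fun k => m (k + 2 * n)) (y * Complex.I)) :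
      moment μ (2 * n) = m (2 * n) ∧
      Integrable (fun x : ℝ => x ^ (2 * n + 1)) (μ : Measure ℝ) ∧
      moment μ (2 * n + 1) = m (2 * n + 1) ∧
      Integrable (fun x : ℝ => x ^ (2 * (n + 1))) (μ : Measure ℝ) ∧
      ∀ y : ℝ, 2 * C < y → weightedCauchy μ (fun x => x ^ (2 * (n + 1))) (y * Complex.I) =
        momentSeries (fun k => m (k + 2 * (n + 1))) (y * Complex.I) := by
    -- The induction moves by two powers because the integrability criterion needs a nonnegative
    -- weight; the odd power in between is dominated by its even neighbours.
    have i2 : Integrable (fun x : ℝ => x ^ (2 * (n + 1))) (μ : Measure ℝ) := by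
      refine (integrable_sq_mul_of_weightedCauchy_eq h1
        (fun x => (even_two_mul n).pow_nonneg x) hC (hm' (2 * n)) h2).congr
        (Eventually.of_forall fun x => ?_)
      ring
    have i1 : Integrable (fun x : ℝ => x ^ (2 * n + 1)) (μ : Measure ℝ) := by
      refine (h1.add i2).mono' (by fun_prop) (Eventually.of_forall fun x => ?_)
      have e1 : x ^ (2 * n + 1) = x ^ (2 * n) * x := pow_succ _ _
      have e2 : x ^ (2 * (n + 1)) = x ^ (2 * n) * x ^ 2 := by ring
      have e0 : 0 ≤ x ^ (2 * n) := (even_two_mul n).pow_nonneg x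
      simp only [Pi.add_apply]
      rw [e1, e2, norm_mul, Real.norm_of_nonneg e0, Real.norm_eq_abs, ← sq_abs x]
      nlinarith [sq_nonneg (|x| - 1), abs_nonneg x]
    obtain ⟨a1, a2⟩ := integral_eq_of_weightedCauchy_eq h1 hC (hm' (2 * n)) h2
    have f1 : (fun x : ℝ => x * x ^ (2 * n)) = fun x => x ^ (2 * n + 1) := by
      ext x
      ring
    rw [f1] at a2
    obtain ⟨b1, b2⟩ := integral_eq_of_weightedCauchy_eq i1 hC
      (m := fun k => m (k + 1 + 2 * n)) (fun k => by
        have := hm' (1 + 2 * n) k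
        rwa [← add_assoc] at this) a2
    have f2 : (fun x : ℝ => x * x ^ (2 * n + 1)) = fun x => x ^ (2 * (n + 1)) := by
      ext x
      ring
    rw [f2] at b2
    refine ⟨by simpa [moment] using a1, i1, ?_, i2, fun y hy => ?_⟩
    · rw [moment, b1]
      congr 1
      ring
    · rw [b2 y hy]
      congr 1
      ext k
      congr 1
      ring
  have key (n : ℕ) : Integrable (fun x : ℝ => x ^ (2 * n)) (μ : Measure ℝ) ∧
      ∀ y : ℝ, 2 * C < y → weightedCauchy μ (fun x => x ^ (2 * n)) (y * Complex.I) =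
        momentSeries (fun k => m (k + 2 * n)) (y * Complex.I) := by
    induction n with
    | zero =>
      refine ⟨by simp, fun y hy => ?_⟩
      simpa [weightedCauchy, cauchyTransform] using h y hy
    | succ n ih =>
      obtain ⟨-, -, -, h4, h5⟩ := step n ih.1 ih.2
      exact ⟨h4, h5⟩
  have all (n : ℕ) : Integrable (fun x : ℝ => x ^ n) (μ : Measure ℝ) ∧ moment μ n = m n := by
    obtain ⟨k, rfl | rfl⟩ := n.even_or_odd'
    · exact ⟨(key k).1, (step k (key k).1 (key k).2).1⟩
    · obtain ⟨-, h2, h3, -, -⟩ := step k (key k).1 (key k).2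
      exact ⟨h2, h3⟩
  exact ⟨fun n => (all n).1, fun n => (all n).2⟩

theorem cauchyTransform_eq_momentSeries {μ : ProbabilityMeasure ℝ} (hμ : HasAllMoments μ) {C : ℝ}
    (hC : 1 ≤ C) (hm : ∀ n, |moment μ n| ≤ C ^ n) {z : ℂ} (hz : 2 * C < z.im) :
    cauchyTransform μ z = momentSeries (moment μ) z := by
  have hz0 : 0 < z.im := by linarith
  have hzn : z.im ≤ ‖z‖ := (le_abs_self _).trans (Complex.abs_im_le_norm z)
  have hne : z ≠ 0 := norm_pos_iff.1 (by linarith)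
  have hexp (n : ℕ) : cauchyTransform μ z =
      ∑ k ∈ Finset.range n, (moment μ k : ℂ) * (z⁻¹) ^ (k + 1) +
        (z⁻¹) ^ n * weightedCauchy μ (fun x => x ^ n) z := by
    induction n with
    | zero => simp [weightedCauchy, cauchyTransform]
    | succ n ih =>
      have h1 := mul_weightedCauchy (hμ n) hz0
      have h2 : (fun x : ℝ => x * x ^ n) = fun x => x ^ (n + 1) := by
        ext x
        ring
      rw [h2] at h1
      have h3 : weightedCauchy μ (fun x => x ^ n) z = z⁻¹ * (moment μ n +
          weightedCauchy μ (fun x => x ^ (n + 1)) z) := by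
        rw [moment, ← h1, inv_mul_cancel_left₀ hne]
      rw [ih, Finset.sum_range_succ, h3]
      ring
  have hsum := (summable_momentSeries (A := 1) hC (fun n => by simpa using hm n)
    (by linarith : 2 * C ≤ ‖z‖)).hasSum.tendsto_sum_nat
  -- Only even truncations are used: there the absolute moment in the remainder is the moment
  -- itself, which the hypothesis bounds.
  have h2n : Tendsto (fun n : ℕ => 2 * n) atTop atTop :=
    tendsto_id.const_mul_atTop' (by norm_num)
  have hrem : Tendsto (fun n : ℕ => (z⁻¹) ^ (2 * n) * weightedCauchy μ (fun x => x ^ (2 * n)) z)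
      atTop (𝓝 0) := by
    have hg : Tendsto (fun n : ℕ => (1 / 2 : ℝ) ^ (2 * n)) atTop (𝓝 0) :=
      (tendsto_pow_atTop_nhds_zero_of_lt_one (by norm_num) (by norm_num)).comp h2n
    refine squeeze_zero_norm (fun n => ?_) hg
    have h1 := norm_integral_mul_inv_sub_le (hμ (2 * n)) hz0
    have h2 : ∫ x : ℝ, |x ^ (2 * n)| ∂(μ : Measure ℝ) = moment μ (2 * n) :=
      integral_congr_ae (Eventually.of_forall fun x => abs_of_nonneg
        ((even_two_mul n).pow_nonneg x))
    rw [h2] at h1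
    have h3 : ‖weightedCauchy μ (fun x => x ^ (2 * n)) z‖ ≤ 1 * C ^ (2 * n) := by
      refine h1.trans ?_
      rw [one_mul]
      refine (div_le_self ?_ (by linarith)).trans ((le_abs_self _).trans (hm _))
      rw [← h2]
      exact integral_nonneg fun x => abs_nonneg _
    have h4 := norm_mul_inv_pow_le hC (by linarith : 2 * C ≤ ‖z‖) (le_refl (2 * n)) zero_le_one h3
    rwa [mul_comm, one_mul] at h4
  have hlim := (hsum.comp h2n).add hrem
  rw [add_zero] at hlim
  refine tendsto_nhds_unique (tendsto_const_nhds.congr fun n => ?_) hlim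
  exact hexp (2 * n)

/-! ### The monotone Poisson distribution. -/

theorem poissonSeries_eq_momentSeries (c : ℝ) (z : ℂ) :
    poissonSeries c z = momentSeries (fun n => poissonPoly n c) z := rfl

theorem isMonotonePoisson_iff {c : ℝ} {ρ : ProbabilityMeasure ℝ} :
    IsMonotonePoisson c ρ ↔ HasAllMoments ρ ∧ ∀ n, moment ρ n = poissonPoly n c := by
  refine and_congr_right fun _ => ⟨fun h n => ?_, fun h n hn => by rw [h, poissonPoly_eq hn]⟩
  rcases Nat.eq_zero_or_pos n with rfl | hn
  · simp [moment, poissonPoly_zero]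
  · rw [h n hn, poissonPoly_eq hn]

theorem IsMonotonePoisson.cauchyTransform_eq {c : ℝ} (hc : 0 < c) {ρ : ProbabilityMeasure ℝ}
    (h : IsMonotonePoisson c ρ) {z : ℂ} (hz : 2 * (2 * Real.exp (c + 1)) < z.im) :
    cauchyTransform ρ z = poissonSeries c z := by
  rw [isMonotonePoisson_iff] at h
  have hexp : 1 ≤ Real.exp (c + 1) := Real.one_le_exp (by linarith)
  rw [cauchyTransform_eq_momentSeries h.1 (C := 2 * Real.exp (c + 1)) (by linarith)
    (fun n => ?_) hz, poissonSeries_eq_momentSeries, funext h.2]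
  rw [h.2]
  exact abs_poissonPoly_le (by rw [abs_of_pos hc]; linarith) n

/-- The Bernoulli law with success probability `p`. -/
theorem exists_bernoulli {p : ℝ} (h0 : 0 ≤ p) (h1 : p ≤ 1) :
    ∃ μ : ProbabilityMeasure ℝ, HasAllMoments μ ∧ ∀ k, 1 ≤ k → moment μ k = p := by
  have hi (f : ℝ → ℝ) (q a : ℝ) : Integrable f (ENNReal.ofReal q • Measure.dirac a) :=
    (integrable_dirac (by simp)).smul_measure ENNReal.ofReal_ne_top
  refine ⟨⟨ENNReal.ofReal (1 - p) • Measure.dirac 0 + ENNReal.ofReal p • Measure.dirac 1, ⟨?_⟩⟩,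
    fun k => (hi _ _ _).add_measure (hi _ _ _), fun k hk => ?_⟩
  · simp [← ENNReal.ofReal_add (sub_nonneg.2 h1) h0]
  · change ∫ x : ℝ, x ^ k ∂(ENNReal.ofReal (1 - p) • Measure.dirac 0 +
      ENNReal.ofReal p • Measure.dirac 1) = p
    rw [integral_add_measure (hi _ _ _) (hi _ _ _), integral_smul_measure, integral_smul_measure,
      integral_dirac, integral_dirac, ENNReal.toReal_ofReal h0]
    simp [zero_pow (by omega : k ≠ 0)]

/-- Existence is itself a limit theorem: convolution powers of Bernoulli laws have Cauchy transforms
tending to the moment series, which is therefore a Cauchy transform with the right moments.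
Uniqueness holds because the geometric moment bound determines `G` near infinity. -/
theorem existsUnique_isMonotonePoisson {c : ℝ} (hc : 0 < c) :
    ∃! ρ : ProbabilityMeasure ℝ, IsMonotonePoisson c ρ := by
  have hexp : 1 ≤ Real.exp (c + 1) := Real.one_le_exp (by linarith)
  have hm (n : ℕ) : |poissonPoly n c| ≤ (2 * Real.exp (c + 1)) ^ n :=
    abs_poissonPoly_le (by rw [abs_of_pos hc]; linarith) n
  have hm1 (n : ℕ) : |poissonPoly n c| ≤ 1 * (2 * Real.exp (c + 1)) ^ n := by simpa using hm n
  -- The minimum keeps the parameter a probability for small `N`; at `N = 0` the quotient is `0`.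
  -- Once `N ≥ c`, `N M_k` equals `c` exactly.
  choose μ hμ hμm using fun N : ℕ => exists_bernoulli (p := min 1 (c / N))
    (le_min zero_le_one (by positivity)) (min_le_left _ _)
  have hlim (k : ℕ) (hk : 1 ≤ k) :
      Tendsto (fun N : ℕ => (N : ℝ) * moment (μ N) k) atTop (𝓝 c) := by
    refine tendsto_const_nhds.congr' ?_
    have hev : ∀ᶠ N : ℕ in atTop, c ≤ (N : ℝ) :=
      tendsto_natCast_atTop_atTop.eventually_ge_atTop c
    filter_upwards [hev] with N hN
    have hN0 : (0 : ℝ) < N := by linarith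
    rw [hμm N k hk, min_eq_right ((div_le_one hN0).2 hN), mul_div_cancel₀ c hN0.ne']
  obtain ⟨ρ, hρ⟩ := exists_cauchyTransform_eq (R := 2 * (2 * Real.exp (c + 1))) (by linarith)
    (fun z hz => tendsto_cauchyTransform_monotoneConvPow_poissonSeries hc (fun N _ => hμ N) hlim hz)
    (by
      have h1 := (tendsto_momentSeries_I (by linarith) (abs_shift_le hm1 1)).const_add
        (poissonPoly 0 c : ℂ)
      rw [add_zero, poissonPoly_zero, Complex.ofReal_one] at h1
      refine h1.congr' ?_
      filter_upwards [eventually_ge_atTop (2 * (2 * Real.exp (c + 1)))] with y hy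
      rw [poissonSeries_eq_momentSeries, mul_momentSeries (by linarith) hm1, poissonPoly_zero,
        Complex.ofReal_one]
      simpa [abs_of_nonneg (by linarith : 0 ≤ y)] using hy)
  refine ⟨ρ, isMonotonePoisson_iff.2 (hasAllMoments_of_cauchyTransform_eq
    (C := 2 * Real.exp (c + 1)) (by linarith) hm fun y hy => hρ _ (by simpa using hy)),
    fun σ hσ => ?_⟩
  refine eq_of_cauchyTransform_eq_of_im_gt (R := 2 * (2 * Real.exp (c + 1))) (by linarith)
    fun z hz => ?_
  rw [hσ.cauchyTransform_eq hc hz, hρ z hz]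

theorem tendsto_monotonePoisson {μ : ℕ → ProbabilityMeasure ℝ} {c : ℝ} (hc : 0 < c)
    (hμ : ∀ N : ℕ, 1 ≤ N → HasAllMoments (μ N))
    (hm : ∀ k : ℕ, 1 ≤ k →
      Tendsto (fun N : ℕ => (N : ℝ) * moment (μ N) k) atTop (𝓝 c)) :
    Tendsto (fun N : ℕ => monotoneConvPow (μ N) N) atTop (𝓝 (monotonePoisson c)) := by
  have hP : IsMonotonePoisson c (monotonePoisson c) :=
    Classical.epsilon_spec (existsUnique_isMonotonePoisson hc).exists
  refine tendsto_of_tendsto_cauchyTransform (R := 2 * (2 * Real.exp (c + 1)))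
    (by positivity) fun z hz => ?_
  rw [hP.cauchyTransform_eq hc hz]
  exact tendsto_cauchyTransform_monotoneConvPow_poissonSeries hc hμ hm hz

end MonotoneConv

theorem mainTheorem6 :
    -- the monotone convolution and the monotone Poisson distribution are well defined
    (∀ μ ν : ProbabilityMeasure ℝ, ∃! ρ : ProbabilityMeasure ℝ,
      MonotoneConv.IsMonotoneConv μ ν ρ) ∧
    (∀ c : ℝ, 0 < c → ∃! ρ : ProbabilityMeasure ℝ, MonotoneConv.IsMonotonePoisson c ρ) ∧
    -- central limit theorem
    (∀ μ : ProbabilityMeasure ℝ, MonotoneConv.HasAllMoments μ →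
      ∫ x : ℝ, x ∂(μ : Measure ℝ) = 0 → variance (fun x : ℝ => x) (μ : Measure ℝ) = 1 →
      Tendsto (fun N : ℕ =>
          MonotoneConv.monotoneConvPow (MonotoneConv.dilation (1 / √(N : ℝ)) μ) N)
        atTop (𝓝 MonotoneConv.arcsineLaw)) ∧
    -- law of small numbers
    (∀ (μ : ℕ → ProbabilityMeasure ℝ) (c : ℝ), 0 < c →
      (∀ N : ℕ, 1 ≤ N → MonotoneConv.HasAllMoments (μ N)) →
      (∀ k : ℕ, 1 ≤ k →
        Tendsto (fun N : ℕ => (N : ℝ) * MonotoneConv.moment (μ N) k) atTop (𝓝 c)) →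
      Tendsto (fun N : ℕ => MonotoneConv.monotoneConvPow (μ N) N)
        atTop (𝓝 (MonotoneConv.monotonePoisson c))) := by
  refine ⟨MonotoneConv.existsUnique_isMonotoneConv,
    fun c hc => MonotoneConv.existsUnique_isMonotonePoisson hc, fun μ hμ h1 h2 => ?_,
    fun μ c hc hμ hm => MonotoneConv.tendsto_monotonePoisson hc hμ hm⟩
  refine MonotoneConv.tendsto_arcsineLaw hμ ?_ ?_
  · simpa [MonotoneConv.moment] using h1
  · rw [variance_of_integral_eq_zero (by fun_prop) h1] at h2
    exact h2
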